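/- Let $k=(k_1,\dots,k_l)$ be positive integers, $n=k_1+\dots+k_l$, and write $z\in\mathbb{C}^n$ in blocks $z=(z_{(1)},\dots,z_{(l)})$ with $z_{(j)}\in\mathbb{C}^{k_j}$. Put $V_k=\prod_{j=1}^l(\mathbb{C}^{k_j}\setminus\{0\})$ and $$\pi_k:V_k\to\prod_{j=1}^l\mathbb{P}^{k_j-1}(\mathbb{C}),\qquad \pi_k(z)=([z_{(1)}],\dots,[z_{(l)}]).$$ The group $(\mathbb{C}^*)^n$ acts componentwise on $\mathbb{C}^n$ and on $V_k$, and blockwise on $\prod_j\mathbb{P}^{k_j-1}(\mathbb{C})$. Consider its subgroups $$A_k=\prod_{j=1}^l\mathbb{C}^*(1,\dots,1)\cong(\mathbb{C}^*)^l,\qquad T_k=\mathbb{T}^n\cap A_k,\qquad B_k=\prod_{j=1}^l\{b\in(\mathbb{C}^*)^{k_j}:b_1\cdots b_{k_j}=1\}.$$ Let $\mathbb{U}^n$ be either $\mathbb{C}^n\subset\mathbb{P}^n(\mathbb{C})$ with the Fubini–Study Kähler structure ($\varepsilon=1$) or the unit ball $\mathbb{B}^n$ with the complex hyperbolic Kähler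 structure ($\varepsilon=-1$), with Kähler form $$\omega=i\,\frac{(1+\varepsilon|z|^2)\sum_r dz_r\wedge d\bar z_r-\varepsilon\sum_{r,s}\bar z_r z_s\,dz_r\wedge d\bar z_s}{(1+\varepsilon|z|^2)^2}.$$ For $p\in\prod_j\mathbb{P}^{k_j-1}(\mathbb{C})$ let $F_p=\pi_k^{-1}(p)\cap\mathbb{U}^n$, let $\mathcal{O}_p$ be the foliation of $F_p$ by $T_k$-orbits, and let $\mathcal{F}_p$ be the foliation of $F_p$ that integrates the orthogonal complement of $T\mathcal{O}_p$ in $TF_p$. A Lagrangian frame on a Kähler manifold is a pair $(\mathcal{O},\mathcal{F})$ of smooth Lagrangian foliations that are orthogonal to each other, with $\mathcal{O}$ Riemannian (the metric is invariant under leaf holonomy) and $\mathcal{F}$ totally geodesic. Then: 1. $\pi_k:V_k\to\prod_j\mathbb{P}^{k_j-1}(\mathbb{C})$ is a holomorphic principal bundle with structure group $A_k$, and the actions of each $b\in B_k$ on $V_k$ and on $\prod_j\mathbb{P}^{k_j-1}(\mathbb{C})$ form an automorphism of this principal bundle: both are biholomorphic, the first commutes with the $A_k$-action, and $\pi_k(b\cdot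 z)=b\cdot\pi_k(z)$. 2. For both choices of $\mathbb{U}^n$, each fiber $F_p$ is a complex submanifold of dimension $l$ and $(\mathcal{O}_p,\mathcal{F}_p)$ is a Lagrangian frame of $F_p$ for the Kähler structure inherited from $\mathbb{U}^n$. The group $\mathbb{T}^n\cap B_k$ acts on $V_k\cap\mathbb{U}^n$ by isometries, and it permutes the fibers and their Lagrangian frames: each $b\in\mathbb{T}^n\cap B_k$ maps $F_p$ onto $F_{b\cdot p}$, each leaf of $\mathcal{O}_p$ onto a leaf of $\mathcal{O}_{b\cdot p}$, and each leaf of $\mathcal{F}_p$ onto a leaf of $\mathcal{F}_{b\cdot p}$. -/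

import Mathlib

open scoped Manifold ContDiff Topology LinearAlgebra.Projectivization

noncomputable section

/-! ### Complex projective space as a complex manifold -/

namespace ProjSpace

variable {m : ℕ}

/-- The quotient topology on `ℙ^{m-1}(ℂ) = (ℂ^m \ {0}) / ℂ*`. -/
instance instTopologicalSpace : TopologicalSpace (ℙ ℂ (Fin m → ℂ)) :=
  TopologicalSpace.coinduced (Projectivization.mk' ℂ) inferInstance

lemma isQuotientMap_mk' : Topology.IsQuotientMap
    (Projectivization.mk' ℂ : {v : Fin m → ℂ // v ≠ 0} → ℙ ℂ (Fin m → ℂ)) :=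
  ⟨⟨rfl⟩, Quotient.mk_surjective⟩

/-- The homogeneous coordinates of `p`, rescaled so that the `i`-th one is `1`; only meaningful
if the `i`-th homogeneous coordinate of `p` does not vanish. -/
def normalized (i : Fin m) (p : ℙ ℂ (Fin m → ℂ)) : Fin m → ℂ :=
  p.lift (fun v : {v : Fin m → ℂ // v ≠ 0} => (v.1 i)⁻¹ • v.1) (by
    rintro ⟨a, ha⟩ ⟨b, hb⟩ t (rfl : a = t • b)
    have ht : t ≠ 0 := by
      rintro rfl
      simp at ha
    ext c
    simp only [Pi.smul_apply, smul_eq_mul, mul_inv]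
    field_simp)

@[simp] lemma normalized_mk (i : Fin m) (v : Fin m → ℂ) (hv : v ≠ 0) :
    normalized i (Projectivization.mk ℂ v hv) = (v i)⁻¹ • v := rfl

/-- The increasing injection `Fin (m - 1) → Fin m` whose image misses `i`. -/
def skip (i : Fin m) (a : Fin (m - 1)) : Fin m :=
  ⟨if a.1 < i.1 then a.1 else a.1 + 1, by split_ifs <;> omega⟩

/-- The vector of `ℂ^m` with `i`-th coordinate `1` whose remaining coordinates are those of `w`,
in order. -/
def insertOne (i : Fin m) (w : Fin (m - 1) → ℂ) (c : Fin m) : ℂ :=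
  if c = i then 1
  else if h : c.1 < i.1 then w ⟨c.1, by omega⟩
  else if h' : i.1 < c.1 then w ⟨c.1 - 1, by omega⟩
  else 1

@[simp] lemma insertOne_self (i : Fin m) (w : Fin (m - 1) → ℂ) : insertOne i w i = 1 := by
  simp [insertOne]

lemma insertOne_ne_zero (i : Fin m) (w : Fin (m - 1) → ℂ) : insertOne i w ≠ 0 := fun h => by
  simpa using congrFun h i

@[simp] lemma insertOne_skip (i : Fin m) (w : Fin (m - 1) → ℂ) (a : Fin (m - 1)) :
    insertOne i w (skip i a) = w a := by
  unfold insertOne skip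
  by_cases h : a.1 < i.1
  · have h1 : (⟨a.1, by omega⟩ : Fin m) ≠ i := fun e => by simp [← e] at h
    simp [h, h1]
  · have h1 : (⟨a.1 + 1, by omega⟩ : Fin m) ≠ i := fun e => by simp [← e] at h
    have h2 : ¬ a.1 + 1 < i.1 := by omega
    have h3 : i.1 < a.1 + 1 := by omega
    simp [h, h1, h2, h3]

lemma insertOne_comp_skip (i : Fin m) (v : Fin m → ℂ) (hv : v i = 1) :
    insertOne i (fun a => v (skip i a)) = v := by
  ext c
  by_cases h : c = i
  · subst h; simp [hv]
  · have h0 : c.1 ≠ i.1 := fun e => h (Fin.ext e)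
    rcases lt_or_gt_of_ne h0 with h1 | h1
    · simp [insertOne, h, h1, skip]
    · have h2 : ¬ c.1 < i.1 := by omega
      have h3 : ¬ c.1 - 1 < i.1 := by omega
      have h4 : c.1 - 1 + 1 = c.1 := by omega
      simp [insertOne, h, h1, h2, h3, skip, h4]

lemma continuous_insertOne (i : Fin m) : Continuous (insertOne i) := by
  refine continuous_pi fun c => ?_
  unfold insertOne
  split_ifs <;> fun_prop

lemma isOpen_preimage_affine (i : Fin m) :
    IsOpen (Projectivization.mk' ℂ ⁻¹' {p : ℙ ℂ (Fin m → ℂ) | normalized i p i ≠ 0}) := by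
  have : Projectivization.mk' ℂ ⁻¹' {p : ℙ ℂ (Fin m → ℂ) | normalized i p i ≠ 0}
      = {v : {v : Fin m → ℂ // v ≠ 0} | v.1 i ≠ 0} := by
    ext v
    simp
  rw [this]
  exact isOpen_ne_fun ((continuous_apply _).comp continuous_subtype_val) continuous_const

/-- The `i`-th affine chart: it is defined where the `i`-th homogeneous coordinate does not vanish
and sends `[v]` to the quotients `v c / v i` for `c ≠ i`. -/
def affineChart (i : Fin m) : OpenPartialHomeomorph (ℙ ℂ (Fin m → ℂ)) (Fin (m - 1) → ℂ) where
  toFun p a := normalized i p (skip i a)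
  invFun w := Projectivization.mk ℂ (insertOne i w) (insertOne_ne_zero i w)
  source := {p | normalized i p i ≠ 0}
  target := Set.univ
  map_source' _ _ := trivial
  map_target' w _ := by simp
  left_inv' p hp := by
    induction p using Projectivization.ind with
    | h v hv =>
      have hvi : v i ≠ 0 := fun h => by simp [h] at hp
      rw [Projectivization.mk_eq_mk_iff']
      exact ⟨(v i)⁻¹, (insertOne_comp_skip _ _ (by simp [hvi])).symm⟩
  right_inv' w _ := by
    ext a
    simp
  open_source := isQuotientMap_mk'.isOpen_preimage.1 (isOpen_preimage_affine i)
  open_target := isOpen_univ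
  continuousOn_toFun := by
    rw [isQuotientMap_mk'.continuousOn_isOpen_iff
      (isQuotientMap_mk'.isOpen_preimage.1 (isOpen_preimage_affine i))]
    refine continuousOn_pi.2 fun a => ?_
    refine ContinuousOn.mul (f := fun v : {v : Fin m → ℂ // v ≠ 0} => (v.1 i)⁻¹)
      (g := fun v => v.1 (skip i a)) ?_
      ((continuous_apply _).comp continuous_subtype_val).continuousOn
    refine ContinuousOn.inv₀
      ((continuous_apply _).comp continuous_subtype_val).continuousOn fun v hv => ?_
    intro h
    exact hv (by simp [h])
  continuousOn_invFun :=
    (isQuotientMap_mk'.continuous.comp ((continuous_insertOne i).subtype_mk (insertOne_ne_zero i))).continuousOn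

lemma exists_mem_affineChart_source (p : ℙ ℂ (Fin m → ℂ)) : ∃ i, p ∈ (affineChart i).source := by
  induction p using Projectivization.ind with
  | h v hv =>
    obtain ⟨i, hi⟩ := Function.ne_iff.1 hv
    exact ⟨i, by simpa [affineChart] using hi⟩

/-- The standard atlas of complex projective space. -/
instance instChartedSpace : ChartedSpace (Fin (m - 1) → ℂ) (ℙ ℂ (Fin m → ℂ)) where
  atlas := Set.range affineChart
  chartAt p := affineChart (exists_mem_affineChart_source p).choose
  mem_chart_source p := (exists_mem_affineChart_source p).choose_spec
  chart_mem_atlas _ := Set.mem_range_self _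

end ProjSpace

/-! ### Holomorphic principal bundles and their automorphisms -/

section PrincipalBundle

variable {EP HP EM HM EG HG : Type*}
  [NormedAddCommGroup EP] [NormedSpace ℂ EP] [TopologicalSpace HP]
  [NormedAddCommGroup EM] [NormedSpace ℂ EM] [TopologicalSpace HM]
  [NormedAddCommGroup EG] [NormedSpace ℂ EG] [TopologicalSpace HG]
  (IP : ModelWithCorners ℂ EP HP) (IM : ModelWithCorners ℂ EM HM) (IG : ModelWithCorners ℂ EG HG)
  {P M : Type*} (G : Type*)
  [TopologicalSpace P] [ChartedSpace HP P] [TopologicalSpace M] [ChartedSpace HM M]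
  [TopologicalSpace G] [ChartedSpace HG G] [CommGroup G] [MulAction G P]

/-- `π : P → M` is a complex (holomorphic) principal fiber bundle with structure group `G`, for the
given action of `G` on `P`. The group is commutative, so left and right actions are the same. -/
structure IsHolomorphicPrincipalBundle (π : P → M) : Prop where
  total_manifold : IsManifold IP ω P
  base_manifold : IsManifold IM ω M
  lieGroup : LieGroup IG ω G
  action_holomorphic : ContMDiff (IG.prod IP) IP ω (fun x : G × P => x.1 • x.2)
  action_free : ∀ (g : G) (u : P), g • u = u → g = 1
  proj_holomorphic : ContMDiff IP IM ω π
  proj_surjective : Function.Surjective π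
  /-- The fibers of `π` are the orbits of `G`. -/
  fiber_eq_orbit : ∀ u v : P, π u = π v ↔ ∃ g : G, g • u = v
  /-- Over some open neighborhood `U` of each point there is a biholomorphism
  `u ↦ (π u, φ u)`, with inverse `ψ`, of `π ⁻¹ U` onto `U × G`, for an equivariant `φ`. -/
  locally_trivial : ∀ x : M, ∃ U : Set M, IsOpen U ∧ x ∈ U ∧ ∃ (φ : P → G) (ψ : M × G → P),
    ContMDiffOn IP IG ω φ (π ⁻¹' U) ∧
    ContMDiffOn (IM.prod IG) IP ω ψ (U ×ˢ Set.univ) ∧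
    (∀ u ∈ π ⁻¹' U, ∀ g : G, φ (g • u) = g * φ u) ∧
    (∀ u ∈ π ⁻¹' U, ψ (π u, φ u) = u) ∧
    (∀ y ∈ U, ∀ g : G, π (ψ (y, g)) = y ∧ φ (ψ (y, g)) = g)

/-- `F` is an automorphism of the principal bundle `π : P → M` with structure group `G` that covers
the transformation `f` of the base: both maps are biholomorphic, `F` commutes with the action of
`G`, and `π ∘ F = f ∘ π`. -/
structure IsPrincipalBundleAutomorphism (π : P → M) (F : P → P) (f : M → M) : Prop where
  biholomorphic : ∃ Φ : P ≃ₘ^ω⟮IP, IP⟯ P, ⇑Φ = F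
  base_biholomorphic : ∃ Φ : M ≃ₘ^ω⟮IM, IM⟯ M, ⇑Φ = f
  equivariant : ∀ (g : G) (u : P), F (g • u) = g • F u
  covers : ∀ u : P, π (F u) = f (π u)

end PrincipalBundle

/-! ### Foliations and Lagrangian frames on submanifolds of a vector space -/

section Foliation

/-- `N` is an embedded complex submanifold of complex dimension `d`: near each of its points it is
the zero set of a holomorphic submersion whose derivative has a kernel of dimension `d`. -/
def IsComplexSubmanifold {E : Type*} [NormedAddCommGroup E] [NormedSpace ℂ E]
    (d : ℕ) (N : Set E) : Prop :=
  ∀ x ∈ N, ∃ (c : ℕ) (f : E → (Fin c → ℂ)), ContDiffAt ℂ ω f x ∧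
    Function.Surjective (fderiv ℂ f x) ∧
    Module.finrank ℂ (LinearMap.ker (fderiv ℂ f x).toLinearMap) = d ∧
    ∀ᶠ y in 𝓝 x, y ∈ N ↔ f y = 0

variable {E : Type*} [NormedAddCommGroup E] [NormedSpace ℝ E]

/-- The tangent space at `x` of a submanifold, or of a leaf of a foliation, `S`: the velocities at
`x` of the smooth curves in `S` through `x`. -/
def tangentSet (S : Set E) (x : E) : Set E :=
  {v | ∃ γ : ℝ → E, ContDiff ℝ ∞ γ ∧ γ 0 = x ∧ (∀ᶠ t in 𝓝 (0 : ℝ), γ t ∈ S) ∧ deriv γ 0 = v}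

/-- The points of `N` that can be reached from `x` by piecewise `C¹` paths in `N` that are tangent
to the distribution `D`. If `D` is integrable, this is the leaf through `x` of its foliation. -/
def accessibleSet (N : Set E) (D : E → Set E) (x : E) : Set E :=
  {y | Relation.ReflTransGen (fun a b => ∃ γ : ℝ → E, ContDiff ℝ 1 γ ∧ γ 0 = a ∧ γ 1 = b ∧
    ∀ t ∈ Set.Icc (0 : ℝ) 1, γ t ∈ N ∧ deriv γ t ∈ D (γ t)) x y}

/-- The tangent distribution of the foliation with leaves `leaf x`. -/
def tangentDist (leaf : E → Set E) (x : E) : Set E :=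
  tangentSet (leaf x) x

/-- The orthogonal complement inside `TN` of the tangent distribution of a foliation of `N`. -/
def normalDist (g : E → E → E → ℝ) (N : Set E) (leaf : E → Set E) (x : E) : Set E :=
  {v ∈ tangentSet N x | ∀ u ∈ tangentDist leaf x, g x u v = 0}

/-- The vector field `X`, defined near `x`, is smooth at `x` and takes its values at the points of
`N` near `x` in the distribution `D`. -/
def IsSectionAt (N : Set E) (D : E → Set E) (X : E → E) (x : E) : Prop :=
  ContDiffAt ℝ ∞ X x ∧ ∀ᶠ y in 𝓝[N] x, X y ∈ D y

/-- The sets `leaf x`, for `x ∈ N`, are the leaves of a smooth foliation of `N` with leaves of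
dimension `d`: their tangent spaces form a smooth involutive distribution of rank `d`, and they are
the maximal connected integral manifolds of that distribution. -/
structure IsSmoothFoliation (N : Set E) (d : ℕ) (leaf : E → Set E) : Prop where
  smooth : ∀ x ∈ N, ∃ X : Fin d → E → E, (∀ i, ContDiffAt ℝ ∞ (X i) x) ∧
    ∀ᶠ y in 𝓝[N] x, LinearIndependent ℝ (fun i => X i y) ∧
      tangentDist leaf y = Submodule.span ℝ (Set.range fun i => X i y)
  involutive : ∀ x ∈ N, ∀ X Y : E → E,
    IsSectionAt N (tangentDist leaf) X x → IsSectionAt N (tangentDist leaf) Y x →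
    VectorField.lieBracket ℝ X Y x ∈ tangentDist leaf x
  leaf_eq : ∀ x ∈ N, leaf x = accessibleSet N (tangentDist leaf) x

/-- The leaves are Lagrangian: each tangent space `T_x L` is its own orthogonal in
`T_x N` with respect to the symplectic form `σ`. -/
def IsLagrangianFoliation (σ : E → E → E → ℝ) (N : Set E) (leaf : E → Set E) : Prop :=
  ∀ x ∈ N, {v ∈ tangentSet N x | ∀ u ∈ tangentDist leaf x, σ x u v = 0} = tangentDist leaf x

/-- The Lie derivative `(L_X g)(Y, Z) = X (g(Y, Z)) - g([X, Y], Z) - g(Y, [X, Z])` at `x`. -/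
def lieDerivMetric (g : E → E → E → ℝ) (X Y Z : E → E) (x : E) : ℝ :=
  fderiv ℝ (fun y => g y (Y y) (Z y)) x (X x)
    - g x (VectorField.lieBracket ℝ X Y x) (Z x) - g x (Y x) (VectorField.lieBracket ℝ X Z x)

/-- The foliation is Riemannian: the metric induced on its normal bundle is invariant under leaf
holonomy, that is, under the flows of the vector fields tangent to the leaves. -/
def IsRiemannianFoliation (g : E → E → E → ℝ) (N : Set E) (leaf : E → Set E) : Prop :=
  ∀ x ∈ N, ∀ X Y Z : E → E, IsSectionAt N (tangentDist leaf) X x →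
    IsSectionAt N (normalDist g N leaf) Y x → IsSectionAt N (normalDist g N leaf) Z x →
    lieDerivMetric g X Y Z x = 0

/-- `g(∇_Y Z, X)` at `x` for the Levi-Civita connection `∇` of `g`, by the Koszul formula. -/
def leviCivita (g : E → E → E → ℝ) (Y Z X : E → E) (x : E) : ℝ :=
  (fderiv ℝ (fun y => g y (Z y) (X y)) x (Y x) + fderiv ℝ (fun y => g y (X y) (Y y)) x (Z x)
    - fderiv ℝ (fun y => g y (Y y) (Z y)) x (X x)
    + g x (VectorField.lieBracket ℝ Y Z x) (X x) - g x (VectorField.lieBracket ℝ Y X x) (Z x)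
    - g x (VectorField.lieBracket ℝ Z X x) (Y x)) / 2

/-- The leaves are totally geodesic in `N`: their second fundamental form vanishes, that is,
`∇_Y Z` has no component normal to the leaves for all `Y`, `Z` tangent to the leaves. -/
def IsTotallyGeodesicFoliation (g : E → E → E → ℝ) (N : Set E) (leaf : E → Set E) : Prop :=
  ∀ x ∈ N, ∀ Y Z X : E → E, IsSectionAt N (tangentDist leaf) Y x →
    IsSectionAt N (tangentDist leaf) Z x → IsSectionAt N (normalDist g N leaf) X x →
    leviCivita g Y Z X x = 0

/-- The pair of foliations with leaves `leafO x` and `leafF x` is a Lagrangian frame of `N`, of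
complex dimension `d`, for the Kähler structure on `N` induced by the Riemannian metric `g` and the
Kähler form `σ` of the ambient space. -/
structure IsLagrangianFrame (g σ : E → E → E → ℝ) (N : Set E) (d : ℕ)
    (leafO leafF : E → Set E) : Prop where
  foliationO : IsSmoothFoliation N d leafO
  foliationF : IsSmoothFoliation N d leafF
  lagrangianO : IsLagrangianFoliation σ N leafO
  lagrangianF : IsLagrangianFoliation σ N leafF
  orthogonal : ∀ x ∈ N, ∀ u ∈ tangentDist leafO x, ∀ v ∈ tangentDist leafF x, g x u v = 0
  riemannianO : IsRiemannianFoliation g N leafO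
  totallyGeodesicF : IsTotallyGeodesicFoliation g N leafF

/-- `f` maps the open set `S` bijectively and smoothly onto itself and preserves the Riemannian
metric `g`. -/
structure IsRiemannianIsometryOn (g : E → E → E → ℝ) (S : Set E) (f : E → E) : Prop where
  bijOn : Set.BijOn f S S
  smooth : ContDiffOn ℝ ∞ f S
  isometric : ∀ z ∈ S, ∀ u v : E, g (f z) (fderiv ℝ f z u) (fderiv ℝ f z v) = g z u v

end Foliation

/-! ### The two Kähler geometries -/

/-- The two cases `𝕌ⁿ = ℂⁿ ⊂ ℙⁿ(ℂ)` and `𝕌ⁿ = 𝔹ⁿ`. -/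
inductive KahlerGeometry
  | projective
  | hyperbolic

namespace KahlerGeometry

variable {ι : Type*} [Fintype ι]

/-- `𝕌ⁿ`: the space `ℂⁿ` in the projective case, its open unit ball in the hyperbolic case. -/
def domain (ι : Type*) [Fintype ι] : KahlerGeometry → Set (EuclideanSpace ℂ ι)
  | projective => Set.univ
  | hyperbolic => Metric.ball 0 1

/-- The sign of the curvature. -/
def sign : KahlerGeometry → ℝ
  | projective => 1
  | hyperbolic => -1

/-- The Hermitian form `∑ h_{kl}(z) u_k conj(v_l)` of the Fubini-Study metric (`ε = 1`), respectively
the complex hyperbolic metric (`ε = -1`), with Kähler form `i ∑ h_{kl} dz_k ∧ d(conj z_l)`, where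
`h_{kl} = ((1 + ε|z|²) δ_{kl} - ε conj(z_k) z_l) / (1 + ε|z|²)²`. -/
def hermitian (X : KahlerGeometry) (z u v : EuclideanSpace ℂ ι) : ℂ :=
  ((1 + X.sign * ‖z‖ ^ 2 : ℝ) * inner ℂ v u - X.sign * (inner ℂ z u * inner ℂ v z)) /
    ((1 + X.sign * ‖z‖ ^ 2 : ℝ) : ℂ) ^ 2

/-- The Riemannian metric `g(u, v) = ω(u, i v)`. -/
def metric (X : KahlerGeometry) (z u v : EuclideanSpace ℂ ι) : ℝ :=
  2 * (X.hermitian z u v).re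

/-- The Kähler form `ω = i ∑ h_{kl} dz_k ∧ d(conj z_l)`. -/
def form (X : KahlerGeometry) (z u v : EuclideanSpace ℂ ι) : ℝ :=
  -2 * (X.hermitian z u v).im

end KahlerGeometry

/-! ### The map `π_k` and the groups that act -/

section Partition

variable {l : ℕ} (k : Fin l → ℕ)

/-- `ℂⁿ` for `n = k_1 + ⋯ + k_l`, with coordinates grouped in blocks: the coordinate `⟨j, a⟩` is the
`a`-th coordinate of `z_(j) ∈ ℂ^{k_j}`. -/
abbrev Cn : Type := EuclideanSpace ℂ (Σ j, Fin (k j))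

/-- The group `(ℂ*)ⁿ`. -/
abbrev CStar : Type := (Σ j, Fin (k j)) → ℂˣ

/-- The base `∏_j ℙ^{k_j - 1}(ℂ)`. -/
abbrev ProjProd : Type := ∀ j, ℙ ℂ (Fin (k j) → ℂ)

/-- The model with corners of the complex manifold `∏_j ℙ^{k_j - 1}(ℂ)`. -/
abbrev projProdModel : ModelWithCorners ℂ (∀ j, Fin (k j - 1) → ℂ)
    (ModelPi fun j => Fin (k j - 1) → ℂ) :=
  ModelWithCorners.pi fun j => 𝓘(ℂ, Fin (k j - 1) → ℂ)

/-- The model with corners of the complex Lie group `(ℂ*)^l`. -/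
abbrev groupModel (l : ℕ) : ModelWithCorners ℂ (Fin l → ℂ) (ModelPi fun _ : Fin l => ℂ) :=
  ModelWithCorners.pi fun _ : Fin l => 𝓘(ℂ, ℂ)

variable {k}

/-- The block `z_(j)` of `z`. -/
def block (z : Cn k) (j : Fin l) : Fin (k j) → ℂ := fun a => z ⟨j, a⟩

/-- The componentwise action of `(ℂ*)ⁿ` on `ℂⁿ`. -/
instance : MulAction (CStar k) (Cn k) where
  smul t z := WithLp.toLp 2 fun i => (t i : ℂ) * z i
  one_smul z := by
    ext i
    exact one_mul (z i)
  mul_smul s t z := by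
    ext i
    exact mul_assoc (s i : ℂ) (t i : ℂ) (z i)

@[simp] lemma cstar_smul_apply (t : CStar k) (z : Cn k) (i : Σ j, Fin (k j)) :
    (t • z) i = (t i : ℂ) * z i := rfl

/-- The componentwise action of an element of `(ℂ*)ⁿ` on the `j`-th block. -/
def blockMap (t : CStar k) (j : Fin l) : (Fin (k j) → ℂ) →ₗ[ℂ] (Fin (k j) → ℂ) where
  toFun v a := (t ⟨j, a⟩ : ℂ) * v a
  map_add' v w := by
    ext a
    exact mul_add _ _ _
  map_smul' c v := by
    ext a
    exact mul_left_comm _ _ _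

lemma blockMap_injective (t : CStar k) (j : Fin l) : Function.Injective (blockMap t j) :=
  fun _ _ h => funext fun a => mul_left_cancel₀ (t ⟨j, a⟩).ne_zero (congrFun h a)

/-- The action of `(ℂ*)ⁿ` on `∏_j ℙ^{k_j - 1}(ℂ)`, the product of the natural actions of
`(ℂ*)^{k_j}` on `ℙ^{k_j - 1}(ℂ)`. -/
instance : MulAction (CStar k) (ProjProd k) where
  smul t p j := (p j).map (blockMap t j) (blockMap_injective t j)
  one_smul p := by
    funext j
    change (p j).map _ _ = p j
    induction p j using Projectivization.ind with
    | h v hv =>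
      rw [Projectivization.map_mk, Projectivization.mk_eq_mk_iff']
      exact ⟨1, by ext a; simp [blockMap]⟩
  mul_smul s t p := by
    funext j
    change (p j).map _ _ = ((p j).map _ _).map _ _
    induction p j using Projectivization.ind with
    | h v hv =>
      rw [Projectivization.map_mk, Projectivization.map_mk, Projectivization.map_mk,
        Projectivization.mk_eq_mk_iff']
      exact ⟨1, by ext a; simp [blockMap, mul_assoc]⟩

variable (k)

/-- `V_k = ∏_j (ℂ^{k_j} \ {0})`, an open subset of `ℂⁿ`. -/
def Vk : TopologicalSpace.Opens (Cn k) where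
  carrier := {z | ∀ j, block z j ≠ 0}
  is_open' := by
    have h : {z : Cn k | ∀ j, block z j ≠ 0} = ⋂ j, {z | block z j ≠ 0} := by
      ext z
      simp
    rw [h]
    refine isOpen_iInter_of_finite fun j => isOpen_ne_fun ?_ continuous_const
    exact continuous_pi fun a => by unfold block; fun_prop

variable {k}

lemma smul_mem_Vk (t : CStar k) {z : Cn k} (hz : z ∈ Vk k) : t • z ∈ Vk k := fun j h =>
  hz j (funext fun a => by simpa [block] using congrFun h a)

/-- The action of `(ℂ*)ⁿ` on `V_k`. -/
instance : MulAction (CStar k) (Vk k) where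
  smul t z := ⟨t • z.1, smul_mem_Vk t z.2⟩
  one_smul z := Subtype.ext (one_smul (CStar k) z.1)
  mul_smul s t z := Subtype.ext (mul_smul s t z.1)

variable (k)

/-- The map `π_k : V_k → ∏_j ℙ^{k_j - 1}(ℂ)`, `z ↦ ([z_(1)], …, [z_(l)])`. -/
def projPi (z : Vk k) : ProjProd k := fun j => Projectivization.mk ℂ (block z.1 j) (z.2 j)

/-- The isomorphism `a ↦ (a_1 1_{[k_1]}, …, a_l 1_{[k_l]})` of `(ℂ*)^l` with
`A_k = ∏_j ℂ* 1_{[k_j]} ⊂ (ℂ*)ⁿ`. -/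
def blockDiag : (Fin l → ℂˣ) →* CStar k where
  toFun a i := a i.1
  map_one' := rfl
  map_mul' _ _ := rfl

/-- The action of `A_k ≅ (ℂ*)^l` on `V_k`: `a · z = (a_1 z_(1), …, a_l z_(l))`. -/
instance : MulAction (Fin l → ℂˣ) (Vk k) := MulAction.compHom (Vk k) (blockDiag k)

/-- The group `A_k = ∏_j ℂ* 1_{[k_j]}` as a subgroup of `(ℂ*)ⁿ`. -/
def Ak : Subgroup (CStar k) := (blockDiag k).range

/-- The compact torus `𝕋ⁿ ⊂ (ℂ*)ⁿ`. -/
def torus : Subgroup (CStar k) where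
  carrier := {t | ∀ i, ‖(t i : ℂ)‖ = 1}
  one_mem' i := by simp
  mul_mem' hs ht i := by simp [hs i, ht i]
  inv_mem' ht i := by simp [ht i]

/-- The torus `T_k = ∏_j 𝕋 1_{[k_j]} = 𝕋ⁿ ∩ A_k`. -/
def Tk : Subgroup (CStar k) := torus k ⊓ Ak k

/-- The group `B_k = ∏_j B_j`, where `B_j = {b ∈ (ℂ*)^{k_j} : b_1 ⋯ b_{k_j} = 1}`. -/
def Bk : Subgroup (CStar k) where
  carrier := {b | ∀ j, ∏ a, b ⟨j, a⟩ = 1}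
  one_mem' j := by simp
  mul_mem' hb hc j := by simp [Finset.prod_mul_distrib, hb j, hc j]
  inv_mem' hb j := by simp [hb j]

variable {k}

/-- `V_k ∩ 𝕌ⁿ`. -/
def VkU (k : Fin l → ℕ) (X : KahlerGeometry) : Set (Cn k) := (Vk k : Set (Cn k)) ∩ X.domain _

/-- The fiber `F_p = π_k⁻¹(p) ∩ V_k ∩ 𝕌ⁿ`. -/
def fiber (X : KahlerGeometry) (p : ProjProd k) : Set (Cn k) :=
  {z | ∃ h : z ∈ Vk k, projPi k ⟨z, h⟩ = p ∧ z ∈ X.domain _}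

/-- The leaf through `z` of the foliation `𝒪_p` of a fiber `F_p` defined by the action of `T_k`. -/
def orbitLeaf (z : Cn k) : Set (Cn k) := {w | ∃ t ∈ Tk k, t • z = w}

/-- The leaf through `z` of the foliation of the fiber `F_p` that integrates the orthogonal
complement of `T𝒪_p` inside `TF_p`. -/
def perpLeaf (X : KahlerGeometry) (p : ProjProd k) (z : Cn k) : Set (Cn k) :=
  accessibleSet (fiber X p) (normalDist X.metric (fiber X p) orbitLeaf) z

end Partition

end

/-! The bundle statement is projective geometry: where one chosen coordinate in each block is
nonzero, normalizing that coordinate to `1` gives a holomorphic section of `π_k`, hence a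
trivialization (`projPi_locally_trivial`). Elements of `(ℂ*)ⁿ` act linearly and commute with `A_k`.

For the frames, everything is expressed in blockwise coefficients. The fiber through `z` is the part
in `𝕌ⁿ` of the orbit `{scale c z}` with all `c_j ≠ 0`, so its tangent space consists of the vectors
`scale c z` with `c ∈ ℂ^l`. The Hermitian form at `z` is real on vectors with real coefficients
(`hermitian_scale_ofReal_im`). Hence real and imaginary coefficients are orthogonal, and since `ω(u,
v) = g(iu, v)` both distributions are Lagrangian. They are treated together as `realDist e` with `e
= I` (orbits) and `e = 1` (complement); their leaves are the sets `expLeaf X e z` of blockwise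
multiples by `exp(e s_j)` (`accessibleSet_fiber`, `orbitLeaf_eq_expLeaf`).

The torus `𝕋ⁿ` acts by unitary maps, and both metrics are built from the Hermitian inner product
alone, so it acts isometrically. As `T_k` also commutes with `scale`, the inner product of fields
with fixed real coefficients is constant along its orbits (`coeffMetric_torus_smul`). This makes
`𝒪_p` Riemannian, and by the Koszul formula the foliation orthogonal to a Riemannian one is totally
geodesic. The explicit form of the leaves shows that the torus permutes them. -/

/-! ### Finite products of manifolds -/

section PiManifold

variable {𝕜 : Type*} [NontriviallyNormedField 𝕜] {ι : Type*} [Fintype ι]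
  {F : ι → Type*} [∀ i, NormedAddCommGroup (F i)] [∀ i, NormedSpace 𝕜 (F i)]
  {H : ι → Type*} [∀ i, TopologicalSpace (H i)] {I : ∀ i, ModelWithCorners 𝕜 (F i) (H i)}
  {M : ι → Type*} [∀ i, TopologicalSpace (M i)] [∀ i, ChartedSpace (H i) (M i)]
  {E' H' N : Type*} [NormedAddCommGroup E'] [NormedSpace 𝕜 E'] [TopologicalSpace H']
  {J : ModelWithCorners 𝕜 E' H'} [TopologicalSpace N] [ChartedSpace H' N] {n : WithTop ℕ∞}

theorem contMDiffWithinAt_pi_iff {f : N → ∀ i, M i} {s : Set N} {x : N} :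
    ContMDiffWithinAt J (ModelWithCorners.pi I) n f s x ↔
      ∀ i, ContMDiffWithinAt J (I i) n (fun y => f y i) s x := by
  simp only [contMDiffWithinAt_iff, forall_and]
  exact and_congr continuousWithinAt_pi contDiffWithinAt_pi

theorem contMDiffOn_pi_iff {f : N → ∀ i, M i} {s : Set N} :
    ContMDiffOn J (ModelWithCorners.pi I) n f s ↔
      ∀ i, ContMDiffOn J (I i) n (fun y => f y i) s :=
  ⟨fun h i x hx => contMDiffWithinAt_pi_iff.1 (h x hx) i,
    fun h x hx => contMDiffWithinAt_pi_iff.2 fun i => h i x hx⟩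

theorem contMDiff_pi_iff {f : N → ∀ i, M i} :
    ContMDiff J (ModelWithCorners.pi I) n f ↔ ∀ i, ContMDiff J (I i) n (fun y => f y i) := by
  simp only [← contMDiffOn_univ, contMDiffOn_pi_iff]

theorem contMDiff_eval (i : ι) :
    ContMDiff (ModelWithCorners.pi I) (I i) n (fun x : ∀ i, M i => x i) :=
  contMDiff_pi_iff.1 contMDiff_id i

/-- A transition map between product charts is a product of transition maps: its `i`-th component
depends only on the `i`-th coordinate. -/
theorem isManifold_pi [∀ i, IsManifold (I i) n (M i)] :
    IsManifold (ModelWithCorners.pi I) n (∀ i, M i) := by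
  refine isManifold_of_contDiffOn _ _ _ ?_
  rintro _ _ ⟨e, he, rfl⟩ ⟨e', he', rfl⟩
  refine contDiffOn_pi.2 fun i => ?_
  have h : ContDiffOn 𝕜 n (I i ∘ (e i).symm ≫ₕ e' i ∘ (I i).symm)
      ((I i).symm ⁻¹' ((e i).symm ≫ₕ e' i).source ∩ Set.range (I i)) :=
    ((contDiffGroupoid n (I i)).compatible (he i trivial) (he' i trivial)).1
  refine h.comp (ContinuousLinearMap.proj (R := 𝕜) (φ := F) i).contDiff.contDiffOn ?_
  rintro x ⟨⟨hx₁, hx₂⟩, y, rfl⟩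
  exact ⟨⟨hx₁ i trivial, hx₂ i trivial⟩, y i, rfl⟩

theorem lieGroup_pi {G : ι → Type*} [∀ i, TopologicalSpace (G i)] [∀ i, ChartedSpace (H i) (G i)]
    [∀ i, Group (G i)] [∀ i, LieGroup (I i) n (G i)] :
    LieGroup (ModelWithCorners.pi I) n (∀ i, G i) where
  toIsManifold := isManifold_pi
  contMDiff_mul := contMDiff_pi_iff.2 fun i =>
    ((contMDiff_eval i).comp contMDiff_fst).mul ((contMDiff_eval i).comp contMDiff_snd)
  contMDiff_inv := contMDiff_pi_iff.2 fun i => (contMDiff_eval i).inv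

end PiManifold

/-! ### Smooth maps into open subsets and into groups of units -/

section Maps

variable {𝕜 : Type*} [NontriviallyNormedField 𝕜]
  {E' H' N : Type*} [NormedAddCommGroup E'] [NormedSpace 𝕜 E'] [TopologicalSpace H']
  {J : ModelWithCorners 𝕜 E' H'} [TopologicalSpace N] [ChartedSpace H' N] {n : WithTop ℕ∞}

theorem contMDiffWithinAt_opens_iff {F : Type*} [NormedAddCommGroup F] [NormedSpace 𝕜 F]
    {U : TopologicalSpace.Opens F} {f : N → U} {s : Set N} {x : N} :
    ContMDiffWithinAt J 𝓘(𝕜, F) n f s x ↔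
      ContMDiffWithinAt J 𝓘(𝕜, F) n (fun y => (f y : F)) s x :=
  (ChartedSpace.liftPropWithinAt_subtypeVal_comp_iff ..).symm

/-- The chart of `Rˣ` is the open embedding into `R`, so in this chart a map is its own underlying
map, and continuity transfers along the embedding. -/
theorem contMDiffWithinAt_units_iff {R : Type*} [NormedRing R] [CompleteSpace R]
    [NormedAlgebra 𝕜 R] {f : N → Rˣ} {s : Set N} {x : N} :
    ContMDiffWithinAt J 𝓘(𝕜, R) n f s x ↔
      ContMDiffWithinAt J 𝓘(𝕜, R) n (fun y => (f y : R)) s x := by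
  rw [contMDiffWithinAt_iff_target]
  refine ⟨fun h => h.2, fun h => ⟨?_, h⟩⟩
  exact Units.isOpenEmbedding_val.isInducing.continuousWithinAt_iff.2 h.continuousWithinAt

end Maps

/-! ### Projective space -/

namespace ProjSpace

variable {m : ℕ}

theorem contDiff_insertOne {n : WithTop ℕ∞} (i : Fin m) : ContDiff ℂ n (insertOne i) := by
  refine contDiff_pi.2 fun c => ?_
  unfold insertOne
  split_ifs <;> fun_prop

/-- The transition maps are quotients of coordinates of `insertOne i w`, with denominator the `j`-th
one, which is nonzero on the overlap. -/
instance isManifold : IsManifold 𝓘(ℂ, Fin (m - 1) → ℂ) ω (ℙ ℂ (Fin m → ℂ)) := by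
  refine isManifold_of_contDiffOn _ _ _ ?_
  rintro _ _ ⟨i, rfl⟩ ⟨j, rfl⟩
  refine contDiffOn_pi.2 fun a => ?_
  have h : ContDiffOn ℂ ω (fun w => (insertOne i w j)⁻¹ * insertOne i w (skip j a))
      {w | insertOne i w j ≠ 0} :=
    (((contDiff_pi.1 (contDiff_insertOne i) j).contDiffOn).inv fun w hw => hw).mul
      (contDiff_pi.1 (contDiff_insertOne i) _).contDiffOn
  refine h.mono ?_
  rintro w ⟨⟨-, hw⟩, -⟩ h0
  refine hw ?_
  change (insertOne i w j)⁻¹ * insertOne i w j = 0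
  rw [h0, mul_zero]

variable {E' H' N : Type*} [NormedAddCommGroup E'] [NormedSpace ℂ E'] [TopologicalSpace H']
  {J : ModelWithCorners ℂ E' H'} [TopologicalSpace N] [ChartedSpace H' N]

theorem contMDiffWithinAt_mk {f : N → Fin m → ℂ} (h0 : ∀ y, f y ≠ 0) {s : Set N} {x : N}
    (hf : ContMDiffWithinAt J 𝓘(ℂ, Fin m → ℂ) ω f s x) :
    ContMDiffWithinAt J 𝓘(ℂ, Fin (m - 1) → ℂ) ω
      (fun y => Projectivization.mk ℂ (f y) (h0 y)) s x := by
  rw [contMDiffWithinAt_iff_target]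
  constructor
  · exact (isQuotientMap_mk'.continuous.continuousAt).comp_continuousWithinAt
      (f := fun y => (⟨f y, h0 y⟩ : {v : Fin m → ℂ // v ≠ 0}))
      (Topology.IsInducing.subtypeVal.continuousWithinAt_iff.2 hf.continuousWithinAt)
  -- The preferred chart at the image point has an index obtained by choice; naming it `i` allows
  -- the local expression `f_c / f_i` to be rewritten.
  · obtain ⟨i, hi⟩ : ∃ i, i = (exists_mem_affineChart_source
        (Projectivization.mk ℂ (f x) (h0 x))).choose := ⟨_, rfl⟩
    have hi' := (exists_mem_affineChart_source (Projectivization.mk ℂ (f x) (h0 x))).choose_spec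
    rw [← hi] at hi'
    have hx : f x i ≠ 0 := fun h => hi' (by simp [h])
    have hf' := contMDiffWithinAt_pi_space.1 hf
    change ContMDiffWithinAt J 𝓘(ℂ, Fin (m - 1) → ℂ) ω (fun y a =>
      (f y (exists_mem_affineChart_source (Projectivization.mk ℂ (f x) (h0 x))).choose)⁻¹ *
      f y (skip (exists_mem_affineChart_source (Projectivization.mk ℂ (f x) (h0 x))).choose a)) s x
    rw [← hi]
    refine contMDiffWithinAt_pi_space.2 fun a => ?_
    have hd : ContDiffAt ℂ ω (fun v : Fin m → ℂ => (v i)⁻¹ * v (skip i a)) (f x) :=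
      ((contDiff_apply ℂ ℂ i).contDiffAt.inv hx).mul (contDiff_apply ℂ ℂ _).contDiffAt
    exact hd.contMDiffAt.comp_contMDiffWithinAt x hf

theorem contMDiffOn_of_eq_mk {f : N → ℙ ℂ (Fin m → ℂ)} {v : N → Fin m → ℂ} {s : Set N}
    (hv : ContMDiffOn J 𝓘(ℂ, Fin m → ℂ) ω v s)
    (hf : ∀ y ∈ s, ∃ h : v y ≠ 0, f y = Projectivization.mk ℂ (v y) h) :
    ContMDiffOn J 𝓘(ℂ, Fin (m - 1) → ℂ) ω f s := by
  classical
  intro x hx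
  -- The lift `v` may vanish outside `s`. Putting the nonzero value `v x` there gives a nowhere
  -- vanishing lift that agrees with `v` on `s`.
  let v' : N → Fin m → ℂ := fun y => if v y = 0 then v x else v y
  have hv' : ∀ y, v' y ≠ 0 := by
    intro y
    by_cases h : v y = 0
    · simpa [v', h] using (hf x hx).1
    · simp [v', h]
  have heq : ∀ y ∈ s, v' y = v y := fun y hy => if_neg (hf y hy).1
  refine (contMDiffWithinAt_mk hv' ((hv x hx).congr heq (heq x hx))).congr_of_mem (fun y hy => ?_) hx
  obtain ⟨h, hy'⟩ := hf y hy
  simp only [hy', heq y hy]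

/-- On the affine chart, `normalized i` is the chart followed by `insertOne i`. It serves as a local
holomorphic lift from projective space to vectors. -/
theorem contMDiffOn_normalized (i : Fin m) :
    ContMDiffOn 𝓘(ℂ, Fin (m - 1) → ℂ) 𝓘(ℂ, Fin m → ℂ) ω (normalized i)
      {p | normalized i p i ≠ 0} := by
  have h : ContMDiffOn 𝓘(ℂ, Fin (m - 1) → ℂ) 𝓘(ℂ, Fin (m - 1) → ℂ) ω (affineChart i)
      (affineChart i).source :=
    contMDiffOn_of_mem_maximalAtlas
      (IsManifold.subset_maximalAtlas (Set.mem_range_self i))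
  refine ((contDiff_insertOne i).contMDiff.comp_contMDiffOn h).congr fun p hp => ?_
  induction p using Projectivization.ind with
  | h v hv =>
    have hvi : v i ≠ 0 := fun h => hp (by simp [h])
    exact (insertOne_comp_skip i _ (by simp [hvi])).symm

theorem mk_normalized (i : Fin m) (p : ℙ ℂ (Fin m → ℂ)) (hp : normalized i p i ≠ 0)
    (h : normalized i p ≠ 0) : Projectivization.mk ℂ (normalized i p) h = p := by
  induction p using Projectivization.ind with
  | h v hv =>
    rw [Projectivization.mk_eq_mk_iff']
    exact ⟨(v i)⁻¹, rfl⟩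

theorem normalized_self (i : Fin m) (p : ℙ ℂ (Fin m → ℂ)) (hp : normalized i p i ≠ 0) :
    normalized i p i = 1 := by
  induction p using Projectivization.ind with
  | h v hv =>
    have hvi : v i ≠ 0 := fun h => by simp [h] at hp
    simp [hvi]

end ProjSpace

/-! ### The principal bundle `π_k` -/

section Bundle

theorem contMDiffWithinAt_toLp {ι E' H' N : Type*} [Fintype ι] [NormedAddCommGroup E']
    [NormedSpace ℂ E'] [TopologicalSpace H'] {J : ModelWithCorners ℂ E' H'} [TopologicalSpace N]
    [ChartedSpace H' N] {f : N → ι → ℂ} {s : Set N} {x : N}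
    (hf : ∀ i, ContMDiffWithinAt J 𝓘(ℂ, ℂ) ω (fun y => f y i) s x) :
    ContMDiffWithinAt J 𝓘(ℂ, EuclideanSpace ℂ ι) ω (fun y => WithLp.toLp 2 (f y)) s x := by
  have h : ContDiff ℂ ω (fun v : ι → ℂ => (WithLp.toLp 2 v : EuclideanSpace ℂ ι)) :=
    (PiLp.continuousLinearEquiv 2 ℂ (fun _ : ι => ℂ)).symm.contDiff
  exact h.contMDiff.contMDiffAt.comp_contMDiffWithinAt x (contMDiffWithinAt_pi_space.2 hf)

variable {l : ℕ} {k : Fin l → ℕ}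

theorem contMDiff_coord (i : Σ j, Fin (k j)) :
    ContMDiff 𝓘(ℂ, Cn k) 𝓘(ℂ, ℂ) ω (fun z : Vk k => z.1 i) := by
  have h : ContDiff ℂ ω (fun z : Cn k => z i) := by fun_prop
  exact h.contMDiff.comp contMDiff_subtype_val

theorem contMDiff_projPi :
    ContMDiff 𝓘(ℂ, Cn k) (projProdModel k) ω (projPi k) :=
  contMDiff_pi_iff.2 fun j _ =>
    ProjSpace.contMDiffWithinAt_mk (f := fun z : Vk k => block z.1 j) (fun z => z.2 j)
      (contMDiffWithinAt_pi_space.2 fun a => contMDiff_coord (k := k) ⟨j, a⟩ _)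

theorem contMDiff_smul_Vk (b : CStar k) :
    ContMDiff 𝓘(ℂ, Cn k) 𝓘(ℂ, Cn k) ω (fun z : Vk k => b • z) := fun _ =>
  contMDiffWithinAt_opens_iff.2 (contMDiffWithinAt_toLp (f := fun (z : Vk k) i => (b i : ℂ) * z.1 i)
    fun i => contMDiffWithinAt_const.mul (contMDiff_coord i _))

/-- Locally each factor is the lift `normalized i`, then a linear map, then the projection. -/
theorem contMDiff_smul_projProd (b : CStar k) :
    ContMDiff (projProdModel k) (projProdModel k) ω (fun p : ProjProd k => b • p) := by
  refine contMDiff_pi_iff.2 fun j => ?_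
  have h : ContMDiff 𝓘(ℂ, Fin (k j - 1) → ℂ) 𝓘(ℂ, Fin (k j - 1) → ℂ) ω
      (fun q : ℙ ℂ (Fin (k j) → ℂ) => q.map (blockMap b j) (blockMap_injective b j)) := by
    intro q
    obtain ⟨i, hi⟩ := ProjSpace.exists_mem_affineChart_source q
    have hs : (ProjSpace.affineChart i).source ∈ 𝓝 q :=
      (ProjSpace.affineChart i).open_source.mem_nhds hi
    have hb : ContDiff ℂ ω (blockMap b j) :=
      (LinearMap.toContinuousLinearMap (blockMap b j)).contDiff
    refine (ProjSpace.contMDiffOn_of_eq_mk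
      (hb.contMDiff.comp_contMDiffOn (ProjSpace.contMDiffOn_normalized i)) ?_).contMDiffAt hs
    intro y hy
    have h0 : ProjSpace.normalized i y ≠ 0 := fun h => hy (by rw [h]; rfl)
    refine ⟨fun h => h0 (blockMap_injective b j (h.trans (map_zero _).symm)), ?_⟩
    conv_lhs => rw [← ProjSpace.mk_normalized i y hy h0]
    rfl
  exact h.comp (contMDiff_eval j)

theorem isPrincipalBundleAutomorphism_smul (b : CStar k) :
    IsPrincipalBundleAutomorphism 𝓘(ℂ, Cn k) (projProdModel k) (Fin l → ℂˣ)
      (projPi k) (fun z => b • z) (fun p => b • p) where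
  biholomorphic := ⟨⟨MulAction.toPerm b, contMDiff_smul_Vk b, contMDiff_smul_Vk b⁻¹⟩, rfl⟩
  base_biholomorphic :=
    ⟨⟨MulAction.toPerm b, contMDiff_smul_projProd b, contMDiff_smul_projProd b⁻¹⟩, rfl⟩
  equivariant g u := by
    change b • (blockDiag k g • u) = blockDiag k g • (b • u)
    rw [smul_smul, smul_smul, mul_comm]
  covers u := rfl

theorem blockDiag_smul_apply (g : Fin l → ℂˣ) (u : Vk k) (i : Σ j, Fin (k j)) :
    (g • u).1 i = (g i.1 : ℂ) * u.1 i := rfl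

theorem projPi_eq_iff (u v : Vk k) : projPi k u = projPi k v ↔ ∃ g : Fin l → ℂˣ, g • u = v := by
  constructor
  · intro h
    have h' : ∀ j, ∃ a : ℂˣ, a • block u.1 j = block v.1 j := fun j =>
      (Projectivization.mk_eq_mk_iff ℂ _ _ _ _).1 (congrFun h j).symm
    choose g hg using h'
    refine ⟨g, Subtype.ext ?_⟩
    ext i
    exact congrFun (hg i.1) i.2
  · rintro ⟨g, rfl⟩
    funext j
    refine (Projectivization.mk_eq_mk_iff ℂ _ _ _ _).2 ⟨(g j)⁻¹, ?_⟩
    ext a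
    change ((g j)⁻¹ : ℂˣ) * ((g j : ℂ) * u.1 ⟨j, a⟩) = u.1 ⟨j, a⟩
    simp

theorem projPi_surjective : Function.Surjective (projPi k) := by
  intro p
  let v : Cn k := WithLp.toLp 2 fun i => (p i.1).rep i.2
  have hv : ∀ j, block v j = (p j).rep := fun j => rfl
  refine ⟨⟨v, fun j => by rw [hv]; exact (p j).rep_nonzero⟩, ?_⟩
  funext j
  exact (p j).mk_rep

theorem projPi_locally_trivial (x : ProjProd k) :
    ∃ U : Set (ProjProd k), IsOpen U ∧ x ∈ U ∧
      ∃ (φ : Vk k → (Fin l → ℂˣ)) (ψ : ProjProd k × (Fin l → ℂˣ) → Vk k),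
      ContMDiffOn 𝓘(ℂ, Cn k) (groupModel l) ω φ (projPi k ⁻¹' U) ∧
      ContMDiffOn ((projProdModel k).prod (groupModel l)) 𝓘(ℂ, Cn k) ω ψ (U ×ˢ Set.univ) ∧
      (∀ u ∈ projPi k ⁻¹' U, ∀ g : Fin l → ℂˣ, φ (g • u) = g * φ u) ∧
      (∀ u ∈ projPi k ⁻¹' U, ψ (projPi k u, φ u) = u) ∧
      (∀ y ∈ U, ∀ g : Fin l → ℂˣ, projPi k (ψ (y, g)) = y ∧ φ (ψ (y, g)) = g) := by
  classical
  -- `u₀` is only a default value for `ψ` off `U`, just as `1` is one for `φ` where a chosen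
  -- coordinate vanishes.
  obtain ⟨u₀, -⟩ := projPi_surjective x
  choose c hc using fun j => ProjSpace.exists_mem_affineChart_source (x j)
  let U : Set (ProjProd k) := {p | ∀ j, ProjSpace.normalized (c j) (p j) (c j) ≠ 0}
  have hUu : ∀ u : Vk k, u ∈ projPi k ⁻¹' U ↔ ∀ j, u.1 ⟨j, c j⟩ ≠ 0 := by
    intro u
    refine forall_congr' fun j => not_congr ?_
    change (u.1 ⟨j, c j⟩)⁻¹ * u.1 ⟨j, c j⟩ = 0 ↔ _
    simp
  let φ : Vk k → (Fin l → ℂˣ) := fun u j =>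
    if h : u.1 ⟨j, c j⟩ = 0 then 1 else Units.mk0 _ h
  have hφ : ∀ u ∈ projPi k ⁻¹' U, ∀ j, (φ u j : ℂ) = u.1 ⟨j, c j⟩ := by
    intro u hu j
    simp [φ, (hUu u).1 hu j]
  -- The section has `c j`-th coordinate `1` in block `j`; after acting by `g` this coordinate is `g
  -- j`, which is what `φ` reads off.
  let s : ProjProd k × (Fin l → ℂˣ) → Cn k := fun q => WithLp.toLp 2 fun i =>
    (q.2 i.1 : ℂ) * ProjSpace.normalized (c i.1) (q.1 i.1) i.2
  let ψ : ProjProd k × (Fin l → ℂˣ) → Vk k := fun q => if h : s q ∈ Vk k then ⟨s q, h⟩ else u₀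
  have hs : ∀ y ∈ U, ∀ g, s (y, g) ∈ Vk k := by
    intro y hy g j h0
    refine hy j ?_
    have := congrFun h0 (c j)
    change (g j : ℂ) * _ = 0 at this
    simpa using this
  have hψ : ∀ y ∈ U, ∀ g, (ψ (y, g)).1 = s (y, g) := by
    intro y hy g
    simp [ψ, hs y hy g]
  have hψc : ∀ y ∈ U, ∀ g j, (ψ (y, g)).1 ⟨j, c j⟩ = g j := by
    intro y hy g j
    rw [hψ y hy g]
    change (g j : ℂ) * _ = g j
    rw [ProjSpace.normalized_self _ _ (hy j), mul_one]
  have hψU : ∀ y ∈ U, ∀ g, projPi k (ψ (y, g)) = y := by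
    intro y hy g
    funext j
    have h0 : ProjSpace.normalized (c j) (y j) ≠ 0 := fun h => hy j (by rw [h]; rfl)
    rw [← ProjSpace.mk_normalized (c j) (y j) (hy j) h0]
    refine (Projectivization.mk_eq_mk_iff ℂ _ _ _ _).2 ⟨g j, ?_⟩
    ext a
    change _ = (ψ (y, g)).1 ⟨j, a⟩
    rw [hψ y hy g]
    rfl
  refine ⟨U, ?_, hc, φ, ψ, ?_, ?_, ?_, ?_, ?_⟩
  · have : U = ⋂ j, (fun p : ProjProd k => p j) ⁻¹' (ProjSpace.affineChart (c j)).source := by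
      ext p
      simp [U, ProjSpace.affineChart]
    rw [this]
    exact isOpen_iInter_of_finite fun j =>
      (ProjSpace.affineChart (c j)).open_source.preimage (continuous_apply j)
  · refine contMDiffOn_pi_iff.2 fun j u hu => contMDiffWithinAt_units_iff.2 ?_
    exact (contMDiff_coord (k := k) ⟨j, c j⟩).contMDiffAt.contMDiffWithinAt.congr_of_mem
      (fun v hv => hφ v hv j) hu
  · rintro ⟨y, g⟩ ⟨hy, -⟩
    refine contMDiffWithinAt_opens_iff.2 ?_
    refine ContMDiffWithinAt.congr_of_mem (f := s) ?_
      (fun q hq => hψ q.1 hq.1 q.2) (show (y, g) ∈ U ×ˢ Set.univ from ⟨hy, trivial⟩)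
    refine contMDiffWithinAt_toLp fun i => ContMDiffWithinAt.mul ?_ ?_
    · exact ((Units.contMDiff_val (𝕜 := ℂ) (R := ℂ)).comp ((contMDiff_eval i.1).comp
        contMDiff_snd)).contMDiffAt.contMDiffWithinAt
    · have h1 : ContMDiffOn ((projProdModel k).prod (groupModel l)) 𝓘(ℂ, Fin (k i.1) → ℂ) ω
          (fun q : ProjProd k × (Fin l → ℂˣ) => ProjSpace.normalized (c i.1) (q.1 i.1))
          (U ×ˢ Set.univ) :=
        (ProjSpace.contMDiffOn_normalized (c i.1)).comp
          ((contMDiff_eval i.1).comp contMDiff_fst).contMDiffOn fun q hq => hq.1 i.1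
      exact contMDiffWithinAt_pi_space.1 (h1 _ ⟨hy, trivial⟩) i.2
  · intro u hu g
    have hgu : g • u ∈ projPi k ⁻¹' U :=
      (hUu _).2 fun j => mul_ne_zero (g j).ne_zero ((hUu u).1 hu j)
    funext j
    ext
    rw [Pi.mul_apply, Units.val_mul, hφ _ hgu, hφ _ hu]
    rfl
  · intro u hu
    apply Subtype.ext
    rw [hψ _ hu]
    ext i
    change (φ u i.1 : ℂ) * ((u.1 ⟨i.1, c i.1⟩)⁻¹ * u.1 i) = u.1 i
    rw [hφ u hu, mul_inv_cancel_left₀ ((hUu u).1 hu i.1)]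
  · intro y hy g
    refine ⟨hψU y hy g, ?_⟩
    funext j
    ext
    rw [hφ _ (show projPi k (ψ (y, g)) ∈ U by rw [hψU y hy g]; exact hy), hψc y hy]

theorem isHolomorphicPrincipalBundle_projPi :
    IsHolomorphicPrincipalBundle 𝓘(ℂ, Cn k) (projProdModel k) (groupModel l) (Fin l → ℂˣ)
      (projPi k) where
  total_manifold := inferInstance
  base_manifold := isManifold_pi
  lieGroup := lieGroup_pi
  action_holomorphic := fun _ => contMDiffWithinAt_opens_iff.2 (contMDiffWithinAt_toLp
    (f := fun (x : (Fin l → ℂˣ) × Vk k) i => (x.1 i.1 : ℂ) * x.2.1 i) fun i =>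
      (((Units.contMDiff_val (𝕜 := ℂ) (R := ℂ)).comp ((contMDiff_eval i.1).comp
        contMDiff_fst)).mul ((contMDiff_coord i).comp contMDiff_snd)).contMDiffAt)
  action_free g u h := by
    funext j
    obtain ⟨a, ha⟩ := Function.ne_iff.1 (u.2 j)
    have h1 : (g j : ℂ) * u.1 ⟨j, a⟩ = u.1 ⟨j, a⟩ := by
      rw [← blockDiag_smul_apply g u ⟨j, a⟩, h]
    ext
    exact mul_right_cancel₀ ha (h1.trans (one_mul _).symm)
  proj_holomorphic := contMDiff_projPi
  proj_surjective := projPi_surjective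
  fiber_eq_orbit := projPi_eq_iff
  locally_trivial := projPi_locally_trivial

end Bundle

/-! ### Algebra of the Hermitian form -/

namespace KahlerGeometry

variable {ι : Type*} [Fintype ι] (X : KahlerGeometry) (z : EuclideanSpace ℂ ι)

theorem one_add_sign_mul_norm_sq_pos {z : EuclideanSpace ℂ ι} (hz : z ∈ X.domain ι) :
    0 < 1 + X.sign * ‖z‖ ^ 2 := by
  cases X with
  | projective => simp only [sign]; positivity
  | hyperbolic =>
    have h : ‖z‖ < 1 := by simpa [domain] using hz
    simp only [sign]
    nlinarith [norm_nonneg z]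

theorem isOpen_domain : IsOpen (X.domain ι) := by
  cases X with
  | projective => exact isOpen_univ
  | hyperbolic => exact Metric.isOpen_ball

theorem hermitian_smul_left (a : ℂ) (u v : EuclideanSpace ℂ ι) :
    X.hermitian z (a • u) v = a * X.hermitian z u v := by
  simp only [hermitian, inner_smul_right]
  ring

theorem hermitian_conj_symm (u v : EuclideanSpace ℂ ι) :
    starRingEnd ℂ (X.hermitian z u v) = X.hermitian z v u := by
  simp only [hermitian, map_div₀, map_sub, map_mul, map_pow, inner_conj_symm, Complex.conj_ofReal]
  ring

theorem metric_add_left (u u' v : EuclideanSpace ℂ ι) :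
    X.metric z (u + u') v = X.metric z u v + X.metric z u' v := by
  simp only [metric, hermitian, inner_add_right, ← mul_add, ← Complex.add_re]
  congr 2
  ring

theorem metric_comm (u v : EuclideanSpace ℂ ι) : X.metric z u v = X.metric z v u := by
  simp only [metric]
  rw [← hermitian_conj_symm, Complex.conj_re]

theorem metric_add_right (u v v' : EuclideanSpace ℂ ι) :
    X.metric z u (v + v') = X.metric z u v + X.metric z u v' := by
  rw [metric_comm, metric_add_left, metric_comm, X.metric_comm z v']

theorem metric_smul_smul (e : ℂ) (u v : EuclideanSpace ℂ ι) :
    X.metric z (e • u) (e • v) = ‖e‖ ^ 2 * X.metric z u v := by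
  have h : X.hermitian z (e • u) (e • v) = (‖e‖ ^ 2 : ℝ) * X.hermitian z u v := by
    rw [hermitian_smul_left, ← hermitian_conj_symm, hermitian_smul_left, map_mul,
      hermitian_conj_symm, ← mul_assoc, Complex.mul_conj']
    push_cast
    rfl
  simp only [metric, h, Complex.re_ofReal_mul]
  ring

/-- Reduces Lagrangian conditions to orthogonality. -/
theorem form_eq_metric (u v : EuclideanSpace ℂ ι) :
    X.form z u v = X.metric z (Complex.I • u) v := by
  simp [form, metric, hermitian_smul_left]

/-- The numerator is `(1 + ε|z|²)|u|² - ε|⟨z, u⟩|²`. For `ε = 1` Cauchy–Schwarz bounds it below by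
`|u|²`; for `ε = -1` it is a positive term plus a square. -/
theorem metric_self_pos {z : EuclideanSpace ℂ ι} (hz : z ∈ X.domain ι) {u : EuclideanSpace ℂ ι}
    (hu : u ≠ 0) : 0 < X.metric z u u := by
  have hp := X.one_add_sign_mul_norm_sq_pos hz
  have h : X.hermitian z u u = (((1 + X.sign * ‖z‖ ^ 2) * ‖u‖ ^ 2
      - X.sign * ‖inner ℂ z u‖ ^ 2) / (1 + X.sign * ‖z‖ ^ 2) ^ 2 : ℝ) := by
    have h1 : inner ℂ z u * inner ℂ u z = ((‖inner ℂ z u‖ ^ 2 : ℝ) : ℂ) := by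
      rw [← inner_conj_symm u z, Complex.mul_conj']
      push_cast
      rfl
    rw [hermitian, h1, inner_self_eq_norm_sq_to_K]
    push_cast
    rfl
  rw [metric, h, Complex.ofReal_re]
  have hu' : 0 < ‖u‖ ^ 2 := by positivity
  refine mul_pos two_pos (div_pos ?_ (by positivity))
  cases X with
  | projective =>
    have hcs : ‖inner ℂ z u‖ ^ 2 ≤ (‖z‖ * ‖u‖) ^ 2 :=
      pow_le_pow_left₀ (norm_nonneg _) (norm_inner_le_norm z u) 2
    simp only [sign]
    nlinarith
  | hyperbolic =>
    simp only [sign] at hp ⊢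
    nlinarith [mul_pos hp hu', sq_nonneg ‖inner ℂ z u‖]

theorem differentiableAt_metric {E : Type*} [NormedAddCommGroup E] [NormedSpace ℝ E]
    {f u v : E → EuclideanSpace ℂ ι} {x : E} (hx : f x ∈ X.domain ι)
    (hf : DifferentiableAt ℝ f x) (hu : DifferentiableAt ℝ u x) (hv : DifferentiableAt ℝ v x) :
    DifferentiableAt ℝ (fun y => X.metric (f y) (u y) (v y)) x := by
  have hc : DifferentiableAt ℝ (fun y => ((1 + X.sign * ‖f y‖ ^ 2 : ℝ) : ℂ)) x :=
    Complex.ofRealCLM.differentiableAt.comp x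
      ((hf.norm_sq ℂ).const_mul X.sign |>.const_add 1)
  have h : DifferentiableAt ℝ (fun y => X.hermitian (f y) (u y) (v y)) x := by
    have h0 : ((1 + X.sign * ‖f x‖ ^ 2 : ℝ) : ℂ) ^ 2 ≠ 0 :=
      pow_ne_zero _ (Complex.ofReal_ne_zero.2 (X.one_add_sign_mul_norm_sq_pos hx).ne')
    simp only [hermitian, div_eq_mul_inv]
    refine DifferentiableAt.fun_mul ?_ ((hc.fun_pow 2).fun_inv h0)
    exact (hc.mul (hv.inner ℂ hu)).sub (((hf.inner ℂ hu).mul (hv.inner ℂ hf)).const_mul _)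
  exact (Complex.reCLM.differentiableAt.comp x h).const_mul 2

end KahlerGeometry

/-! ### Blockwise scaling -/

section Scale

variable {l : ℕ} {k : Fin l → ℕ}

/-- `(c_1 z_(1), …, c_l z_(l))`. -/
noncomputable def scale (c : Fin l → ℂ) (z : Cn k) : Cn k := WithLp.toLp 2 fun i => c i.1 * z i

@[simp] theorem scale_apply (c : Fin l → ℂ) (z : Cn k) (i : Σ j, Fin (k j)) :
    scale c z i = c i.1 * z i := rfl

theorem add_scale (c d : Fin l → ℂ) (z : Cn k) : scale (c + d) z = scale c z + scale d z := by
  ext i; simp [add_mul]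

theorem scale_add (c : Fin l → ℂ) (z w : Cn k) : scale c (z + w) = scale c z + scale c w := by
  ext i; simp [mul_add]

theorem smul_scale (a : ℂ) (c : Fin l → ℂ) (z : Cn k) : scale (a • c) z = a • scale c z := by
  ext i; simp [mul_assoc]

theorem scale_scale (c d : Fin l → ℂ) (z : Cn k) : scale c (scale d z) = scale (c * d) z := by
  ext i; simp [mul_assoc]

/-- Scaling as a continuous real bilinear map. -/
noncomputable def scaleBilin : (Fin l → ℂ) →L[ℝ] Cn k →L[ℝ] Cn k :=
  LinearMap.toContinuousBilinearMap
    (LinearMap.mk₂ ℝ scale add_scale (fun a c z => by ext i; simp [mul_assoc]) scale_add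
      (fun a c z => by ext i; simp [mul_left_comm]))

/-- These coordinates recover the coefficients `c j` from the vector `scale c z` by division. -/
theorem exists_coord_ne_zero {z : Cn k} (hz : z ∈ Vk k) :
    ∃ a : ∀ j, Fin (k j), ∀ j, z ⟨j, a j⟩ ≠ 0 := by
  choose a ha using fun j => Function.ne_iff.1 (hz j)
  exact ⟨a, ha⟩

theorem scale_injective {z : Cn k} (hz : z ∈ Vk k) : Function.Injective fun c => scale c z := by
  obtain ⟨a, ha⟩ := exists_coord_ne_zero hz
  intro c d h
  funext j
  exact mul_right_cancel₀ (ha j) (congrArg (fun w : Cn k => w ⟨j, a j⟩) h)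

theorem scale_mem_fiber {X : KahlerGeometry} {p : ProjProd k} {z : Cn k} (hz : z ∈ fiber X p)
    {c : Fin l → ℂ} (hc : ∀ j, c j ≠ 0) (hd : scale c z ∈ X.domain _) : scale c z ∈ fiber X p := by
  obtain ⟨h, hp, -⟩ := hz
  have hs : (fun j => Units.mk0 (c j) (hc j)) • (⟨z, h⟩ : Vk k)
      = ⟨scale c z, smul_mem_Vk (blockDiag k fun j => Units.mk0 (c j) (hc j)) h⟩ := rfl
  exact ⟨_, ((projPi_eq_iff _ _).2 ⟨_, hs⟩).symm.trans hp, hd⟩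

theorem exists_scale_eq {X : KahlerGeometry} {p : ProjProd k} {z w : Cn k} (hz : z ∈ fiber X p)
    (hw : w ∈ fiber X p) : ∃ c : Fin l → ℂ, (∀ j, c j ≠ 0) ∧ w = scale c z := by
  obtain ⟨h, hp, -⟩ := hz
  obtain ⟨h', hp', -⟩ := hw
  obtain ⟨g, hg⟩ := (projPi_eq_iff ⟨z, h⟩ ⟨w, h'⟩).1 (hp.trans hp'.symm)
  exact ⟨fun j => g j, fun j => (g j).ne_zero, (congrArg Subtype.val hg).symm⟩

theorem norm_scale_sq (c : Fin l → ℂ) (z : Cn k) :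
    ‖scale c z‖ ^ 2 = ∑ i, ‖c i.1‖ ^ 2 * ‖z i‖ ^ 2 := by
  simp [EuclideanSpace.norm_sq_eq, mul_pow]

/-- The inner product at `z` of the vectors with real coefficients `s` and `r` in the blocks of `z`. -/
noncomputable def coeffMetric (X : KahlerGeometry) (z : Cn k) (s r : Fin l → ℝ) : ℝ :=
  X.metric z (scale (fun j => (s j : ℂ)) z) (scale (fun j => (r j : ℂ)) z)

theorem hermitian_scale_ofReal_im (X : KahlerGeometry) (z : Cn k) (s r : Fin l → ℝ) :
    (X.hermitian z (scale (fun j => (s j : ℂ)) z) (scale (fun j => (r j : ℂ)) z)).im = 0 := by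
  have h : ∀ s r : Fin l → ℝ, inner ℂ (scale (fun j => (s j : ℂ)) z)
      (scale (fun j => (r j : ℂ)) z) = ((∑ i, s i.1 * r i.1 * ‖z i‖ ^ 2 : ℝ) : ℂ) := by
    intro s r
    simp only [PiLp.inner_apply, scale_apply, RCLike.inner_apply, map_mul, Complex.conj_ofReal]
    push_cast
    refine Finset.sum_congr rfl fun i _ => ?_
    rw [← Complex.mul_conj']
    ring
  -- The base point itself has real coefficients, so its inner products in the Hermitian form are
  -- also real by `h`.
  have h1 : scale (fun _ => ((1 : ℝ) : ℂ)) z = z := by ext i; simp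
  have h2 := fun r => h (fun _ => 1) r
  have h3 := fun r => h r (fun _ => 1)
  simp only [h1] at h2 h3
  rw [KahlerGeometry.hermitian, h, h2, h3]
  norm_cast

/-- The Hermitian form is real on real coefficients, so multiplying one argument by `I` makes its
real part vanish; the common factor `e` only contributes `‖e‖ ^ 2`. -/
theorem metric_scale (X : KahlerGeometry) (z : Cn k) (e : ℂ) (s a b : Fin l → ℝ) :
    X.metric z (scale (fun j => e * s j) z) (scale (fun j => e * (a j + Complex.I * b j)) z)
      = ‖e‖ ^ 2 * coeffMetric X z s a := by
  have h1 : scale (fun j => e * s j) z = e • scale (fun j => (s j : ℂ)) z := by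
    ext i; simp [mul_assoc]
  have h2 : scale (fun j => e * (a j + Complex.I * b j)) z
      = e • (scale (fun j => (a j : ℂ)) z + Complex.I • scale (fun j => (b j : ℂ)) z) := by
    ext i; simp; ring
  have h3 : X.metric z (scale (fun j => (s j : ℂ)) z) (Complex.I • scale (fun j => (b j : ℂ)) z)
      = 0 := by
    rw [KahlerGeometry.metric_comm, KahlerGeometry.metric, KahlerGeometry.hermitian_smul_left,
      Complex.I_mul_re, hermitian_scale_ofReal_im]
    simp
  rw [h1, h2, KahlerGeometry.metric_smul_smul, KahlerGeometry.metric_add_right, h3, add_zero,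
    coeffMetric]

theorem coeffMetric_comm (X : KahlerGeometry) (z : Cn k) (s r : Fin l → ℝ) :
    coeffMetric X z s r = coeffMetric X z r s := X.metric_comm _ _ _

theorem coeffMetric_self_eq_zero {X : KahlerGeometry} {z : Cn k} (hz : z ∈ VkU k X)
    {s : Fin l → ℝ} (h : coeffMetric X z s s = 0) : s = 0 := by
  have h0 : scale (fun j => (s j : ℂ)) z = 0 := by
    by_contra hne
    exact (X.metric_self_pos hz.2 hne).ne' h
  have h1 : scale (fun j => (s j : ℂ)) z = scale 0 z := by rw [h0]; ext i; simp
  funext j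
  simpa using congrFun (scale_injective hz.1 h1) j

end Scale

/-! ### Tangent spaces and leaves -/

section Leaves

variable {l : ℕ} {k : Fin l → ℕ}

/-- The distribution of the vectors `(e s_1 z_(1), …, e s_l z_(l))` with real `s_j`. -/
def realDist (e : ℂ) (z : Cn k) : Set (Cn k) :=
  {v | ∃ s : Fin l → ℝ, v = scale (fun j => e * s j) z}

/-- The points `(exp(e s_1) z_(1), …, exp(e s_l) z_(l))` of `𝕌ⁿ` with real `s_j`. -/
def expLeaf (X : KahlerGeometry) (e : ℂ) (z : Cn k) : Set (Cn k) :=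
  {w | (∃ s : Fin l → ℝ, w = scale (fun j => Complex.exp (e * s j)) z) ∧ w ∈ X.domain _}

/-- The curve `t ↦ (exp(t c_1) z_(1), …, exp(t c_l) z_(l))`. -/
noncomputable def expCurve (c : Fin l → ℂ) (z : Cn k) (t : ℝ) : Cn k :=
  scale (fun j => Complex.exp (t * c j)) z

@[simp] theorem expCurve_zero (c : Fin l → ℂ) (z : Cn k) : expCurve c z 0 = z := by
  ext i; simp [expCurve]

theorem expCurve_one (c : Fin l → ℂ) (z : Cn k) :
    expCurve c z 1 = scale (fun j => Complex.exp (c j)) z := by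
  simp [expCurve]

theorem contDiff_expCurve {n : WithTop ℕ∞} (c : Fin l → ℂ) (z : Cn k) :
    ContDiff ℝ n (expCurve c z) := by
  have h : ContDiff ℝ n fun (t : ℝ) (j : Fin l) => Complex.exp (t * c j) :=
    contDiff_pi.2 fun j => (Complex.ofRealCLM.contDiff.mul contDiff_const).cexp
  exact (scaleBilin (k := k)).flip z |>.contDiff.comp h

theorem hasDerivAt_expCurve (c : Fin l → ℂ) (z : Cn k) (t : ℝ) :
    HasDerivAt (expCurve c z) (scale c (expCurve c z t)) t := by
  have h : HasDerivAt (fun (t : ℝ) (j : Fin l) => Complex.exp (t * c j))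
      (fun j => Complex.exp (t * c j) * (1 * c j)) t :=
    hasDerivAt_pi.2 fun j => ((Complex.ofRealCLM.hasDerivAt (x := t)).mul_const (c j)).cexp
  have h' : scale c (expCurve c z t) = scale (fun j => Complex.exp (t * c j) * (1 * c j)) z := by
    ext i
    simp only [expCurve, scale_apply]
    ring
  rw [h']
  exact ((scaleBilin (k := k)).flip z).hasFDerivAt.comp_hasDerivAt t h

theorem continuous_expCurve (c : Fin l → ℂ) (z : Cn k) : Continuous (expCurve c z) :=
  (contDiff_expCurve (n := 0) c z).continuous

variable {X : KahlerGeometry} {p : ProjProd k} {z : Cn k}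

theorem mem_VkU_of_mem_fiber (hz : z ∈ fiber X p) : z ∈ VkU k X := ⟨hz.1, hz.2.2⟩

theorem eventually_expCurve_mem_domain (hz : z ∈ X.domain _) (c : Fin l → ℂ) :
    ∀ᶠ t in 𝓝 (0 : ℝ), expCurve c z t ∈ X.domain _ :=
  (continuous_expCurve c z).continuousAt.eventually_mem
    (X.isOpen_domain.mem_nhds (by simpa using hz))

/-- The `i`-th coordinate as a real linear map. -/
noncomputable def coordCLM (i : Σ j, Fin (k j)) : Cn k →L[ℝ] ℂ :=
  (EuclideanSpace.proj i : Cn k →L[ℂ] ℂ).restrictScalars ℝ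

theorem hasDerivAt_coord {γ : ℝ → Cn k} {t : ℝ} (h : DifferentiableAt ℝ γ t)
    (i : Σ j, Fin (k j)) : HasDerivAt (fun t => γ t i) (deriv γ t i) t :=
  (coordCLM i).hasFDerivAt.comp_hasDerivAt t h.hasDerivAt

/-- The coefficients can be taken as quotients of coordinates of `γ t` by nonzero coordinates of `γ
0`, so they are differentiable at `0`. -/
theorem exists_scale_curve {γ : ℝ → Cn k} (hγ : DifferentiableAt ℝ γ 0) (hz : γ 0 ∈ Vk k)
    (h : ∀ᶠ t in 𝓝 (0 : ℝ), ∃ c, γ t = scale c (γ 0)) :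
    ∃ (c : ℝ → Fin l → ℂ) (c' : Fin l → ℂ), (∀ j, HasDerivAt (fun t => c t j) (c' j) 0) ∧
      (∀ j, c 0 j = 1) ∧ (∀ᶠ t in 𝓝 (0 : ℝ), γ t = scale (c t) (γ 0)) ∧
      deriv γ 0 = scale c' (γ 0) := by
  obtain ⟨a, ha⟩ := exists_coord_ne_zero hz
  have hcoord : ∀ i, HasDerivAt (fun t => γ t i) (deriv γ 0 i) 0 := hasDerivAt_coord hγ
  have hc : ∀ᶠ t in 𝓝 (0 : ℝ), γ t = scale (fun j => γ t ⟨j, a j⟩ / γ 0 ⟨j, a j⟩) (γ 0) := by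
    filter_upwards [h] with t ⟨c, hc⟩
    have : (fun j => γ t ⟨j, a j⟩ / γ 0 ⟨j, a j⟩) = c := by
      funext j
      rw [hc, scale_apply, mul_div_cancel_right₀ _ (ha j)]
    rw [this, hc]
  refine ⟨fun t j => γ t ⟨j, a j⟩ / γ 0 ⟨j, a j⟩, fun j => deriv γ 0 ⟨j, a j⟩ / γ 0 ⟨j, a j⟩,
    fun j => (hcoord _).div_const _, fun j => div_self (ha j), hc, ?_⟩
  ext i
  refine (hcoord i).unique ?_
  have h1 := ((hcoord ⟨i.1, a i.1⟩).div_const (γ 0 ⟨i.1, a i.1⟩)).mul_const (γ 0 i)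
  refine h1.congr_of_eventuallyEq ?_
  filter_upwards [hc] with t ht
  exact congrArg (fun w : Cn k => w i) ht

theorem tangentSet_fiber (hz : z ∈ fiber X p) :
    tangentSet (fiber X p) z = {v | ∃ c, v = scale c z} := by
  ext v
  constructor
  · rintro ⟨γ, hγ, rfl, hmem, rfl⟩
    obtain ⟨c, c', -, -, -, h⟩ := exists_scale_curve (hγ.differentiable (by simp) 0) hz.1
      (hmem.mono fun t ht => let ⟨c, _, hc⟩ := exists_scale_eq hz ht; ⟨c, hc⟩)
    exact ⟨c', h⟩
  · rintro ⟨c, rfl⟩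
    refine ⟨expCurve c z, contDiff_expCurve c z, expCurve_zero c z, ?_, ?_⟩
    · filter_upwards [eventually_expCurve_mem_domain hz.2.2 c] with t ht
      exact scale_mem_fiber hz (fun j => Complex.exp_ne_zero _) ht
    · rw [(hasDerivAt_expCurve c z 0).deriv, expCurve_zero]

/-- For `e = I` the principal logarithm may shift the exponent by a multiple of `2πi`, so `r` need
not be `s`. -/
theorem exists_log_exp_eq {e : ℂ} (he : e = 1 ∨ e = Complex.I) (s : ℝ) :
    ∃ r : ℝ, Complex.log (Complex.exp (e * s)) = e * r := by
  rcases he with rfl | rfl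
  · exact ⟨s, by rw [one_mul, ← Complex.ofReal_exp, ← Complex.ofReal_log
      (Real.exp_pos s).le, Real.log_exp]⟩
  · refine ⟨(Complex.log (Complex.exp (Complex.I * s))).im, ?_⟩
    apply Complex.ext
    · simp [Complex.log_re, Complex.norm_exp]
    · simp

theorem tangentSet_expLeaf {e : ℂ} (he : e = 1 ∨ e = Complex.I) (hz : z ∈ VkU k X) :
    tangentSet (expLeaf X e z) z = realDist e z := by
  ext v
  constructor
  · rintro ⟨γ, hγ, rfl, hmem, rfl⟩
    obtain ⟨c, c', hc', hc0, hc, h⟩ := exists_scale_curve (hγ.differentiable (by simp) 0) hz.1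
      (hmem.mono fun t ht => let ⟨s, hs⟩ := ht.1; ⟨_, hs⟩)
    have he0 : e ≠ 0 := by rcases he with rfl | rfl <;> simp
    -- Near `t = 0` the logarithm of each coefficient lies in `eℝ`; since the coefficient is `1` at
    -- `0`, its logarithmic derivative there is `c' j`.
    have hreal : ∀ j, (c' j / e).im = 0 := by
      intro j
      have hlog : HasDerivAt (fun t => (Complex.log (c t j) / e).im) (c' j / e).im 0 := by
        have h1 : HasDerivAt (fun t => Complex.log (c t j) / e) (c' j / c 0 j / e) 0 :=
          (HasDerivAt.clog_real (hc' j) (by simp [hc0])).div_const e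
        rw [hc0, div_one] at h1
        exact Complex.imCLM.hasFDerivAt.comp_hasDerivAt (0 : ℝ) h1
      refine hlog.unique ((hasDerivAt_const (0 : ℝ) (0 : ℝ)).congr_of_eventuallyEq ?_)
      filter_upwards [hc, hmem] with t ht ⟨⟨s, hs⟩, _⟩
      have hcs := congrFun (scale_injective hz.1 (ht.symm.trans hs)) j
      obtain ⟨r, hr⟩ := exists_log_exp_eq he (s j)
      rw [hcs, hr, mul_div_cancel_left₀ _ he0, Complex.ofReal_im]
    refine ⟨fun j => (c' j / e).re, h.trans (congrArg (scale · (γ 0)) ?_)⟩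
    funext j
    rw [show ((c' j / e).re : ℂ) = c' j / e from Complex.ext rfl (hreal j).symm,
      mul_div_cancel₀ _ he0]
  · rintro ⟨s, rfl⟩
    refine ⟨expCurve (fun j => e * s j) z, contDiff_expCurve _ z, expCurve_zero _ z, ?_, ?_⟩
    · filter_upwards [eventually_expCurve_mem_domain hz.2 fun j => e * s j] with t ht
      refine ⟨⟨fun j => t * s j, ?_⟩, ht⟩
      simp only [expCurve]
      congr 1
      funext j
      push_cast
      ring_nf
    · rw [(hasDerivAt_expCurve _ z 0).deriv, expCurve_zero]

/-- A nowhere vanishing solution of `f' = e σ f` with real `σ` satisfies `f(1) = exp(e S) f(0)` for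
some real `S`. -/
theorem exists_exp_mul_eq {f : ℝ → ℂ} (hf : ContDiff ℝ 1 f) {e : ℂ} (he : e ≠ 0)
    (h0 : ∀ t ∈ Set.Icc (0 : ℝ) 1, f t ≠ 0)
    (hd : ∀ t ∈ Set.Icc (0 : ℝ) 1, ∃ σ : ℝ, deriv f t = e * σ * f t) :
    ∃ S : ℝ, f 1 = Complex.exp (e * S) * f 0 := by
  have hcd : Continuous (deriv f) := hf.continuous_deriv le_rfl
  let σ : ℝ → ℝ := fun t => (deriv f t / (e * f t)).re
  have hσ : ∀ t ∈ Set.Icc (0 : ℝ) 1, deriv f t = e * σ t * f t := by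
    intro t ht
    obtain ⟨r, hr⟩ := hd t ht
    have : σ t = r := by
      simp only [σ, hr]
      rw [mul_right_comm, mul_div_cancel_left₀ _ (mul_ne_zero he (h0 t ht)), Complex.ofReal_re]
    rw [this, hr]
  have hσc : ContinuousOn σ (Set.Icc 0 1) :=
    Complex.continuous_re.comp_continuousOn (hcd.continuousOn.div
      (continuousOn_const.mul hf.continuous.continuousOn) fun t ht => mul_ne_zero he (h0 t ht))
  -- `σ` is controlled only on `[0, 1]`; its constant extension is continuous on `ℝ` and has a
  -- primitive `G`.
  let Q : ℝ → ℝ := Set.IccExtend zero_le_one ((Set.Icc (0 : ℝ) 1).domRestrict σ)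
  have hQ : Continuous Q := hσc.domRestrict.Icc_extend'
  have hQσ : ∀ t ∈ Set.Icc (0 : ℝ) 1, Q t = σ t := fun t ht => Set.IccExtend_of_mem _ _ ht
  let G : ℝ → ℝ := fun t => ∫ τ in (0 : ℝ)..t, Q τ
  have hG : ∀ t, HasDerivAt G (Q t) t := fun t =>
    intervalIntegral.integral_hasDerivAt_right (hQ.intervalIntegrable _ _)
      hQ.stronglyMeasurable.stronglyMeasurableAtFilter hQ.continuousAt
  -- Integrating factor: `F` is constant on `[0, 1]`.
  let F : ℝ → ℂ := fun t => f t * Complex.exp (-(e * G t))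
  have hF : ∀ t, HasDerivAt F (deriv f t * Complex.exp (-(e * G t))
      + f t * (Complex.exp (-(e * G t)) * -(e * Q t))) t := fun t =>
    (hf.differentiable one_ne_zero t).hasDerivAt.mul
      (((Complex.ofRealCLM.hasFDerivAt.comp_hasDerivAt t (hG t)).const_mul e).neg.cexp)
  have hconst := constant_of_has_deriv_right_zero (f := F) (a := 0) (b := 1)
    (fun t _ => (hF t).continuousAt.continuousWithinAt) (fun t ht => by
      have ht' := Set.Ico_subset_Icc_self ht
      have h := (hF t).hasDerivWithinAt (s := Set.Ici t)
      rw [hσ t ht', hQσ t ht'] at h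
      convert h using 1
      ring) 1 (Set.right_mem_Icc.2 zero_le_one)
  have hG0 : G 0 = 0 := intervalIntegral.integral_same
  simp only [F, hG0, Complex.ofReal_zero, mul_zero, neg_zero, Complex.exp_zero, mul_one] at hconst
  refine ⟨G 1, ?_⟩
  rw [← hconst, mul_left_comm, ← Complex.exp_add]
  simp

/-- The squared norm along the curve is a sum of real exponentials in `t` with nonnegative weights,
hence convex. A curve with both ends in the ball thus stays in it, so `expLeaf` is not cut into
pieces by the ball. -/
theorem expCurve_mem_domain (hz : z ∈ X.domain _) {c : Fin l → ℂ}
    (hw : expCurve c z 1 ∈ X.domain _) {t : ℝ} (ht : t ∈ Set.Icc (0 : ℝ) 1) :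
    expCurve c z t ∈ X.domain _ := by
  cases X with
  | projective => exact Set.mem_univ _
  | hyperbolic =>
    have key : ∀ w : Cn k, w ∈ KahlerGeometry.hyperbolic.domain (Σ j, Fin (k j)) ↔ ‖w‖ ^ 2 < 1 := by
      intro w
      simp [KahlerGeometry.domain, sq_lt_one_iff_abs_lt_one]
    rw [key] at hz hw ⊢
    have hconv : ‖expCurve c z t‖ ^ 2 ≤ (1 - t) * ‖z‖ ^ 2 + t * ‖expCurve c z 1‖ ^ 2 := by
      rw [expCurve, expCurve, norm_scale_sq, norm_scale_sq, EuclideanSpace.norm_sq_eq,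
        Finset.mul_sum, Finset.mul_sum, ← Finset.sum_add_distrib]
      refine Finset.sum_le_sum fun i _ => ?_
      have h := convexOn_exp.2 (Set.mem_univ 0) (Set.mem_univ (2 * (c i.1).re))
        (sub_nonneg.2 ht.2) ht.1 (by ring)
      have h2 : ∀ τ : ℝ, ‖Complex.exp (τ * c i.1)‖ ^ 2 = Real.exp (τ * (2 * (c i.1).re)) := by
        intro τ
        rw [Complex.norm_exp, ← Real.exp_nat_mul]
        simp
        ring
      rw [h2, h2]
      simp only [smul_eq_mul, mul_zero, zero_add, Real.exp_zero, mul_one, one_mul] at h ⊢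
      nlinarith [mul_le_mul_of_nonneg_right h (sq_nonneg ‖z i‖)]
    have h1 : (1 - t) * ‖z‖ ^ 2 ≤ (1 - t) * 1 :=
      mul_le_mul_of_nonneg_left hz.le (sub_nonneg.2 ht.2)
    rcases ht.1.eq_or_lt with h0 | h0
    · rw [← h0, expCurve_zero]; exact hz
    · nlinarith [mul_lt_mul_of_pos_left hw h0]

/-- Along a path tangent to `D`, one nonzero coordinate per block solves `f' = e σ f`, so
`exists_exp_mul_eq` gives its total factor, and exponents add when paths are joined. Conversely, a
single exponential curve reaches each point of the leaf. -/
theorem accessibleSet_fiber {e : ℂ} (he : e ≠ 0) {D : Cn k → Set (Cn k)}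
    (hD : ∀ w ∈ fiber X p, D w = realDist e w) (hz : z ∈ fiber X p) :
    accessibleSet (fiber X p) D z = expLeaf X e z := by
  ext w
  constructor
  · intro hw
    suffices h : w ∈ fiber X p ∧ w ∈ expLeaf X e z from h.2
    change Relation.ReflTransGen _ z w at hw
    induction hw with
    | refl => exact ⟨hz, ⟨0, by ext i; simp⟩, hz.2.2⟩
    | @tail b w' _ hstep ih =>
      obtain ⟨γ, hγ, rfl, rfl, hγD⟩ := hstep
      obtain ⟨hb, ⟨s, hs⟩, -⟩ := ih
      have hw' := (hγD 1 (Set.right_mem_Icc.2 zero_le_one)).1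
      refine ⟨hw', ?_, hw'.2.2⟩
      obtain ⟨a, ha⟩ := exists_coord_ne_zero hb.1
      have hcoord : ∀ i t, HasDerivAt (fun t => γ t i) (deriv γ t i) t := fun i t =>
        hasDerivAt_coord (hγ.differentiable one_ne_zero t) i
      have hS : ∀ j, ∃ S : ℝ, γ 1 ⟨j, a j⟩ = Complex.exp (e * S) * γ 0 ⟨j, a j⟩ := by
        intro j
        refine exists_exp_mul_eq (f := fun t => γ t ⟨j, a j⟩)
          ((coordCLM ⟨j, a j⟩).contDiff.comp hγ) he (fun t ht => ?_) fun t ht => ?_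
        · obtain ⟨c, hc, hct⟩ := exists_scale_eq hb (hγD t ht).1
          rw [hct]
          exact mul_ne_zero (hc j) (ha j)
        · obtain ⟨hm, hd⟩ := hγD t ht
          rw [hD _ hm] at hd
          obtain ⟨σ, hσ⟩ := hd
          refine ⟨σ j, ?_⟩
          rw [(hcoord _ t).deriv, hσ, scale_apply]
      choose S hS using hS
      obtain ⟨c, -, hc⟩ := exists_scale_eq hb hw'
      have hcS : c = fun j => Complex.exp (e * S j) := by
        funext j
        refine mul_right_cancel₀ (ha j) ?_
        rw [← hS j, hc, scale_apply]
      refine ⟨S + s, ?_⟩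
      rw [hc, hcS, hs, scale_scale]
      congr 1
      funext j
      simp [mul_add, Complex.exp_add]
  · rintro ⟨⟨s, hs⟩, hw⟩
    have h1 : expCurve (fun j => e * s j) z 1 = w := by rw [expCurve_one, hs]
    refine Relation.ReflTransGen.single ⟨expCurve (fun j => e * s j) z, contDiff_expCurve _ z,
      expCurve_zero _ z, h1, fun t ht => ?_⟩
    have hm : expCurve (fun j => e * s j) z t ∈ fiber X p :=
      scale_mem_fiber hz (fun j => Complex.exp_ne_zero _)
        (expCurve_mem_domain hz.2.2 (by rw [h1]; exact hw) ht)
    refine ⟨hm, ?_⟩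
    rw [hD _ hm, (hasDerivAt_expCurve _ z t).deriv]
    exact ⟨s, rfl⟩

theorem orbitLeaf_eq_expLeaf (hz : z ∈ VkU k X) : orbitLeaf z = expLeaf X Complex.I z := by
  ext w
  constructor
  · rintro ⟨_, ⟨ht, ⟨a, rfl⟩⟩, rfl⟩
    obtain ⟨b, hb⟩ := exists_coord_ne_zero hz.1
    have ha : ∀ j, ∃ θ : ℝ, Complex.exp (θ * Complex.I) = a j := fun j =>
      (Complex.norm_eq_one_iff _).1 (ht ⟨j, b j⟩)
    choose θ hθ using ha
    have hw : blockDiag k a • z = scale (fun j => Complex.exp (Complex.I * θ j)) z := by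
      ext i
      rw [scale_apply, mul_comm Complex.I, hθ]
      rfl
    refine ⟨⟨θ, hw⟩, ?_⟩
    have hn : ‖blockDiag k a • z‖ = ‖z‖ := by
      rw [← sq_eq_sq₀ (norm_nonneg _) (norm_nonneg _), hw, norm_scale_sq,
        EuclideanSpace.norm_sq_eq]
      simp [Complex.norm_exp]
    cases X with
    | projective => exact Set.mem_univ _
    | hyperbolic => simpa [KahlerGeometry.domain, hn] using hz.2
  · rintro ⟨⟨s, rfl⟩, -⟩
    refine ⟨blockDiag k fun j => Units.mk0 _ (Complex.exp_ne_zero (Complex.I * s j)),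
      ⟨fun i => ?_, ⟨_, rfl⟩⟩, rfl⟩
    change ‖Complex.exp (Complex.I * s i.1)‖ = 1
    simp [Complex.norm_exp]

theorem tangentDist_orbitLeaf (hz : z ∈ VkU k X) :
    tangentDist orbitLeaf z = realDist Complex.I z := by
  rw [tangentDist, orbitLeaf_eq_expLeaf hz, tangentSet_expLeaf (Or.inr rfl) hz]

/-- With coefficients `e (a + I b)`, pairing with the vector of coefficients `e a` leaves `‖e‖²`
times the squared length of `a`, so `a = 0`. -/
theorem orthogonal_realDist {e : ℂ} (he : e ≠ 0) (hz : z ∈ fiber X p) :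
    {v ∈ tangentSet (fiber X p) z | ∀ u ∈ realDist e z, X.metric z u v = 0}
      = realDist (Complex.I * e) z := by
  rw [tangentSet_fiber hz]
  ext v
  constructor
  · rintro ⟨⟨c, rfl⟩, h⟩
    have hc : c = fun j => e * (((c j / e).re : ℝ) + Complex.I * ((c j / e).im : ℝ)) := by
      funext j
      rw [mul_comm Complex.I, Complex.re_add_im, mul_div_cancel₀ _ he]
    have h1 := h _ ⟨fun j => (c j / e).re, rfl⟩
    rw [hc, metric_scale] at h1
    have h2 : coeffMetric X z (fun j => (c j / e).re) (fun j => (c j / e).re) = 0 := by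
      simpa [he] using h1
    have h3 := coeffMetric_self_eq_zero (mem_VkU_of_mem_fiber hz) h2
    refine ⟨fun j => (c j / e).im, congrArg (scale · z) (hc.trans ?_)⟩
    funext j
    rw [show (c j / e).re = 0 from congrFun h3 j]
    simp
    ring
  · rintro ⟨s, rfl⟩
    refine ⟨⟨_, rfl⟩, ?_⟩
    rintro _ ⟨r, rfl⟩
    have h := metric_scale X z e r 0 s
    have h0 : coeffMetric X z r 0 = 0 := by
      have h1 : scale (fun j => (((0 : Fin l → ℝ) j : ℝ) : ℂ)) z = (0 : ℂ) • z := by ext i; simp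
      rw [coeffMetric_comm, coeffMetric, h1, KahlerGeometry.metric,
        KahlerGeometry.hermitian_smul_left, zero_mul, Complex.zero_re, mul_zero]
    rw [h0, mul_zero] at h
    convert h using 3
    funext j
    simp
    ring

theorem realDist_neg (e : ℂ) (z : Cn k) : realDist (-e) z = realDist e z := by
  have h : ∀ e : ℂ, realDist (-e) z ⊆ realDist e z := by
    rintro e _ ⟨s, rfl⟩
    exact ⟨-s, by simp⟩
  refine (h e).antisymm ?_
  simpa using h (-e)

theorem normalDist_orbitLeaf (hz : z ∈ fiber X p) :
    normalDist X.metric (fiber X p) orbitLeaf z = realDist 1 z := by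
  rw [normalDist, tangentDist_orbitLeaf (mem_VkU_of_mem_fiber hz),
    orthogonal_realDist Complex.I_ne_zero hz, Complex.I_mul_I, realDist_neg]

theorem perpLeaf_eq_expLeaf (hz : z ∈ fiber X p) : perpLeaf X p z = expLeaf X 1 z :=
  accessibleSet_fiber one_ne_zero (fun _ hw => normalDist_orbitLeaf hw) hz

theorem tangentDist_perpLeaf (hz : z ∈ fiber X p) :
    tangentDist (perpLeaf X p) z = realDist 1 z := by
  rw [tangentDist, perpLeaf_eq_expLeaf hz,
    tangentSet_expLeaf (Or.inl rfl) (mem_VkU_of_mem_fiber hz)]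

theorem normalDist_perpLeaf (hz : z ∈ fiber X p) :
    normalDist X.metric (fiber X p) (perpLeaf X p) z = realDist Complex.I z := by
  rw [normalDist, tangentDist_perpLeaf hz, orthogonal_realDist one_ne_zero hz, mul_one]

/-- The `ω`-orthogonal of `realDist e` is the metric orthogonal of `realDist (I * e)`, namely
`realDist (I * I * e) = realDist e`. -/
theorem lagrangian_realDist {e : ℂ} (he : e ≠ 0) (hz : z ∈ fiber X p) :
    {v ∈ tangentSet (fiber X p) z | ∀ u ∈ realDist e z, X.form z u v = 0} = realDist e z := by
  have h := orthogonal_realDist (mul_ne_zero Complex.I_ne_zero he) hz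
  rw [← mul_assoc, Complex.I_mul_I, neg_one_mul, realDist_neg] at h
  refine Eq.trans ?_ h
  ext v
  refine and_congr_right fun _ => ⟨?_, ?_⟩
  · rintro hv _ ⟨s, rfl⟩
    have := hv _ ⟨s, rfl⟩
    rw [KahlerGeometry.form_eq_metric, ← smul_scale] at this
    convert this using 3
    funext j
    simp [mul_assoc]
  · rintro hv _ ⟨s, rfl⟩
    rw [KahlerGeometry.form_eq_metric, ← smul_scale]
    convert hv _ ⟨s, rfl⟩ using 3
    funext j
    simp [mul_assoc]

end Leaves

/-! ### Vector fields tangent to the leaves -/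

section VectorFields

/-- Sections are ambient fields constrained only along `N`. This lemma replaces them by explicit
formulas valid on `N` when differentiating in tangent directions. -/
theorem fderiv_apply_eq_of_mem_tangentSet {E F : Type*} [NormedAddCommGroup E] [NormedSpace ℝ E]
    [NormedAddCommGroup F] [NormedSpace ℝ F] {N : Set E} {x v : E} {f g : E → F}
    (hf : DifferentiableAt ℝ f x) (hg : DifferentiableAt ℝ g x) (hfg : f =ᶠ[𝓝[N] x] g)
    (hv : v ∈ tangentSet N x) : fderiv ℝ f x v = fderiv ℝ g x v := by
  obtain ⟨γ, hγ, rfl, hN, rfl⟩ := hv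
  have hd : HasDerivAt γ (deriv γ 0) 0 := (hγ.differentiable (by simp) 0).hasDerivAt
  refine (hf.hasFDerivAt.comp_hasDerivAt (0 : ℝ) hd).unique
    ((hg.hasFDerivAt.comp_hasDerivAt (0 : ℝ) hd).congr_of_eventuallyEq ?_)
  exact (tendsto_nhdsWithin_iff.2 ⟨hγ.continuous.continuousAt, hN⟩).eventually hfg

variable {l : ℕ} {k : Fin l → ℕ} {X : KahlerGeometry} {p : ProjProd k} {x : Cn k} {e f : ℂ}
  {D : Cn k → Set (Cn k)} {V W : Cn k → Cn k} {s r : Cn k → Fin l → ℝ}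

/-- Division by a nonzero coordinate gives the coefficients; the real part keeps them real off the
fiber too and changes nothing on it. -/
theorem exists_coeff (he : e ≠ 0) (hx : x ∈ fiber X p)
    (hD : ∀ w ∈ fiber X p, D w = realDist e w) (hV : IsSectionAt (fiber X p) D V x) :
    ∃ s : Cn k → Fin l → ℝ, DifferentiableAt ℝ s x ∧
      V =ᶠ[𝓝[fiber X p] x] fun y => scale (fun j => e * s y j) y := by
  obtain ⟨a, ha⟩ := exists_coord_ne_zero hx.1
  have hVd : DifferentiableAt ℝ V x := hV.1.differentiableAt (by simp)
  refine ⟨fun y j => (V y ⟨j, a j⟩ / (e * y ⟨j, a j⟩)).re, ?_, ?_⟩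
  · refine differentiableAt_pi.2 fun j => ?_
    have h1 : DifferentiableAt ℝ (fun y : Cn k => e * y ⟨j, a j⟩) x :=
      (coordCLM ⟨j, a j⟩).differentiableAt.const_mul e
    have h2 : DifferentiableAt ℝ (fun y => V y ⟨j, a j⟩ / (e * y ⟨j, a j⟩)) x := by
      simp only [div_eq_mul_inv]
      exact ((coordCLM ⟨j, a j⟩).differentiableAt.comp x hVd).fun_mul
        (h1.fun_inv (mul_ne_zero he (ha j)))
    exact Complex.reCLM.differentiableAt.comp x h2
  · filter_upwards [hV.2, self_mem_nhdsWithin] with y hy hyN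
    rw [hD y hyN] at hy
    obtain ⟨s, hs⟩ := hy
    obtain ⟨c, hc, hyc⟩ := exists_scale_eq hx hyN
    have h0 : ∀ j, y ⟨j, a j⟩ ≠ 0 := fun j => by
      rw [hyc]
      exact mul_ne_zero (hc j) (ha j)
    have : ∀ j, (V y ⟨j, a j⟩ / (e * y ⟨j, a j⟩)).re = s j := fun j => by
      rw [hs, scale_apply, mul_right_comm, mul_div_cancel_left₀ _ (mul_ne_zero he (h0 j)),
        Complex.ofReal_re]
    simp only [this]
    exact hs

theorem eq_scale_of_eventuallyEq (hx : x ∈ fiber X p)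
    (hV : V =ᶠ[𝓝[fiber X p] x] fun y => scale (fun j => e * s y j) y) :
    V x = scale (fun j => e * s x j) x :=
  hV.eq_of_nhdsWithin hx

theorem fderiv_section_apply (hx : x ∈ fiber X p) (hVd : DifferentiableAt ℝ V x)
    (hs : DifferentiableAt ℝ s x)
    (hV : V =ᶠ[𝓝[fiber X p] x] fun y => scale (fun j => e * s y j) y) (c : Fin l → ℂ) :
    fderiv ℝ V x (scale c x)
      = scale (fun j => e * fderiv ℝ s x (scale c x) j + e * s x j * c j) x := by
  let M : (Fin l → ℝ) →L[ℝ] (Fin l → ℂ) :=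
    ContinuousLinearMap.pi fun j =>
      (ContinuousLinearMap.mul ℝ ℂ e).comp (Complex.ofRealCLM.comp (ContinuousLinearMap.proj j))
  have hM : HasFDerivAt (fun y j => e * (s y j : ℂ)) (M.comp (fderiv ℝ s x)) x :=
    M.hasFDerivAt.comp x hs.hasFDerivAt
  have hB := (scaleBilin (k := k)).hasFDerivAt_of_bilinear hM (hasFDerivAt_id x)
  have hv : scale c x ∈ tangentSet (fiber X p) x := by
    rw [tangentSet_fiber hx]
    exact ⟨c, rfl⟩
  rw [fderiv_apply_eq_of_mem_tangentSet hVd hB.differentiableAt hV hv, hB.fderiv]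
  ext i
  change e * (s x i.1 : ℂ) * (c i.1 * x i) + e * (fderiv ℝ s x (scale c x) i.1 : ℂ) * x i = _
  rw [scale_apply]
  ring

/-- The terms `e s_j f r_j` from differentiating the base point are symmetric in the two fields and
cancel, leaving the derivatives of the coefficients. -/
theorem lieBracket_section (hx : x ∈ fiber X p)
    (hVd : DifferentiableAt ℝ V x) (hs : DifferentiableAt ℝ s x)
    (hV : V =ᶠ[𝓝[fiber X p] x] fun y => scale (fun j => e * s y j) y)
    (hWd : DifferentiableAt ℝ W x) (hr : DifferentiableAt ℝ r x)
    (hW : W =ᶠ[𝓝[fiber X p] x] fun y => scale (fun j => f * r y j) y) :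
    VectorField.lieBracket ℝ V W x
      = scale (fun j => f * fderiv ℝ r x (V x) j - e * fderiv ℝ s x (W x) j) x := by
  have hVx := eq_scale_of_eventuallyEq hx hV
  have hWx := eq_scale_of_eventuallyEq hx hW
  have h1 := fderiv_section_apply hx hWd hr hW (fun j => e * s x j)
  have h2 := fderiv_section_apply hx hVd hs hV (fun j => f * r x j)
  rw [← hVx] at h1
  rw [← hWx] at h2
  rw [VectorField.lieBracket, h1, h2]
  ext i
  simp only [PiLp.sub_apply, scale_apply]
  ring

/-! ### Invariance under the compact torus -/

theorem inner_torus_smul {b : CStar k} (hb : b ∈ torus k) (u v : Cn k) :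
    inner ℂ (b • u) (b • v) = inner ℂ u v := by
  simp only [PiLp.inner_apply, cstar_smul_apply, RCLike.inner_apply, map_mul]
  refine Finset.sum_congr rfl fun i _ => ?_
  have h : (b i : ℂ) * starRingEnd ℂ (b i : ℂ) = 1 := by
    rw [Complex.mul_conj', hb i]
    simp
  linear_combination (v i * starRingEnd ℂ (u i)) * h

theorem norm_torus_smul {b : CStar k} (hb : b ∈ torus k) (u : Cn k) : ‖b • u‖ = ‖u‖ := by
  rw [@norm_eq_sqrt_re_inner ℂ, inner_torus_smul hb, ← @norm_eq_sqrt_re_inner ℂ]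

theorem metric_torus_smul {b : CStar k} (hb : b ∈ torus k) (z u v : Cn k) :
    X.metric (b • z) (b • u) (b • v) = X.metric z u v := by
  simp only [KahlerGeometry.metric, KahlerGeometry.hermitian, inner_torus_smul hb,
    norm_torus_smul hb]

theorem torus_smul_mem_domain {b : CStar k} (hb : b ∈ torus k) {z : Cn k} :
    b • z ∈ X.domain _ ↔ z ∈ X.domain _ := by
  cases X with
  | projective => exact Iff.rfl
  | hyperbolic => simp [KahlerGeometry.domain, norm_torus_smul hb]

theorem smul_scale_comm (b : CStar k) (c : Fin l → ℂ) (z : Cn k) :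
    b • scale c z = scale c (b • z) := by
  ext i
  simp [mul_left_comm]

/-- The torus is isometric and commutes with `scale`, so vectors with fixed coefficients are carried
along with the base point. -/
theorem coeffMetric_torus_smul {b : CStar k} (hb : b ∈ torus k) (z : Cn k) (s r : Fin l → ℝ) :
    coeffMetric X (b • z) s r = coeffMetric X z s r := by
  rw [coeffMetric, ← smul_scale_comm, ← smul_scale_comm, metric_torus_smul hb, coeffMetric]

/-- `coeffMetric` as a continuous bilinear map. -/
noncomputable def coeffMetricBilin (X : KahlerGeometry) (z : Cn k) :
    (Fin l → ℝ) →L[ℝ] (Fin l → ℝ) →L[ℝ] ℝ := by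
  have add_left : ∀ s s' r : Fin l → ℝ,
      coeffMetric X z (s + s') r = coeffMetric X z s r + coeffMetric X z s' r := by
    intro s s' r
    rw [coeffMetric, coeffMetric, coeffMetric, ← KahlerGeometry.metric_add_left, ← add_scale]
    congr 2
    funext j
    simp
  have smul_left : ∀ (a : ℝ) (s r : Fin l → ℝ),
      coeffMetric X z (a • s) r = a • coeffMetric X z s r := by
    intro a s r
    have h : scale (fun j => ((a • s) j : ℂ)) z = (a : ℂ) • scale (fun j => (s j : ℂ)) z := by
      ext i
      simp [mul_assoc]
    rw [coeffMetric, h, KahlerGeometry.metric, KahlerGeometry.hermitian_smul_left,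
      Complex.re_ofReal_mul, coeffMetric, KahlerGeometry.metric, smul_eq_mul]
    ring
  exact LinearMap.toContinuousBilinearMap (LinearMap.mk₂ ℝ (coeffMetric X z) add_left smul_left
    (fun s r r' => by simp only [coeffMetric_comm X z s, add_left])
    (fun a s r => by simp only [coeffMetric_comm X z s, smul_left]))

@[simp] theorem coeffMetricBilin_apply (z : Cn k) (s r : Fin l → ℝ) :
    coeffMetricBilin X z s r = coeffMetric X z s r := rfl

theorem expLeaf_subset_fiber (hx : x ∈ fiber X p) : expLeaf X e x ⊆ fiber X p := by
  rintro _ ⟨⟨s, rfl⟩, hd⟩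
  exact scale_mem_fiber hx (fun j => Complex.exp_ne_zero _) hd

/-- The derivative along an orbit of the inner product of two fields normal to the orbits. -/
theorem fderiv_metric_apply (hx : x ∈ fiber X p)
    (hVd : DifferentiableAt ℝ V x) (hs : DifferentiableAt ℝ s x)
    (hV : V =ᶠ[𝓝[fiber X p] x] fun y => scale (fun j => 1 * s y j) y)
    (hWd : DifferentiableAt ℝ W x) (hr : DifferentiableAt ℝ r x)
    (hW : W =ᶠ[𝓝[fiber X p] x] fun y => scale (fun j => 1 * r y j) y)
    {u : Cn k} (hu : u ∈ realDist Complex.I x) :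
    fderiv ℝ (fun y => X.metric y (V y) (W y)) x u
      = coeffMetric X x (fderiv ℝ s x u) (r x) + coeffMetric X x (s x) (fderiv ℝ r x u) := by
  have hB := (coeffMetricBilin X x).hasFDerivAt_of_bilinear hs.hasFDerivAt hr.hasFDerivAt
  -- On the `T_k`-orbit of `x` the metric coefficients may be frozen at `x`; this suffices because
  -- `u` is tangent to the orbit.
  have heq : (fun y => X.metric y (V y) (W y)) =ᶠ[𝓝[expLeaf X Complex.I x] x]
      fun y => coeffMetricBilin X x (s y) (r y) := by
    have hmono := nhdsWithin_mono x (expLeaf_subset_fiber (e := Complex.I) hx)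
    filter_upwards [hV.filter_mono hmono, hW.filter_mono hmono, self_mem_nhdsWithin]
      with y hVy hWy hy
    rw [← orbitLeaf_eq_expLeaf (mem_VkU_of_mem_fiber hx)] at hy
    obtain ⟨t, ht, rfl⟩ := hy
    rw [coeffMetricBilin_apply, ← coeffMetric_torus_smul ht.1, coeffMetric, hVy, hWy]
    simp only [one_mul]
  rw [← tangentSet_expLeaf (Or.inr rfl) (mem_VkU_of_mem_fiber hx)] at hu
  rw [fderiv_apply_eq_of_mem_tangentSet (X.differentiableAt_metric hx.2.2 differentiableAt_fun_id
    hVd hWd) hB.differentiableAt heq hu, hB.fderiv]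
  simp [add_comm]

/-! ### The Lagrangian frame -/

theorem metric_scale_I_sub (z : Cn k) (a b s : Fin l → ℝ) :
    X.metric z (scale (fun j => 1 * a j - Complex.I * b j) z) (scale (fun j => 1 * s j) z)
      = coeffMetric X z a s := by
  have h := metric_scale X z 1 s a (-b)
  rw [KahlerGeometry.metric_comm, coeffMetric_comm]
  simp only [norm_one, one_pow, one_mul] at h ⊢
  rw [← h]
  congr 2
  funext j
  simp [sub_eq_add_neg]

/-- The derivative of `g(Y, Z)` along `V` only sees the derivatives of the coefficients of `Y` and
`Z`. These are also the normal components of `[V, Y]` and `[V, Z]`, so all terms cancel. -/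
theorem isRiemannianFoliation_orbitLeaf :
    IsRiemannianFoliation X.metric (fiber X p) orbitLeaf := by
  intro x hx V Y Z hV hY hZ
  obtain ⟨θ, hθ, hVθ⟩ := exists_coeff Complex.I_ne_zero hx
    (fun w hw => tangentDist_orbitLeaf (mem_VkU_of_mem_fiber hw)) hV
  obtain ⟨s, hs, hYs⟩ := exists_coeff one_ne_zero hx (fun w hw => normalDist_orbitLeaf hw) hY
  obtain ⟨r, hr, hZr⟩ := exists_coeff one_ne_zero hx (fun w hw => normalDist_orbitLeaf hw) hZ
  have hVd : DifferentiableAt ℝ V x := hV.1.differentiableAt (by simp)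
  have hYd : DifferentiableAt ℝ Y x := hY.1.differentiableAt (by simp)
  have hZd : DifferentiableAt ℝ Z x := hZ.1.differentiableAt (by simp)
  rw [lieDerivMetric, fderiv_metric_apply hx hYd hs hYs hZd hr hZr
    ⟨θ x, eq_scale_of_eventuallyEq hx hVθ⟩, lieBracket_section hx hVd hθ hVθ hYd hs hYs,
    lieBracket_section hx hVd hθ hVθ hZd hr hZr, X.metric_comm x (Y x),
    eq_scale_of_eventuallyEq hx hYs, eq_scale_of_eventuallyEq hx hZr,
    metric_scale_I_sub, metric_scale_I_sub, coeffMetric_comm X x (s x)]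
  ring

/-- In the Koszul formula `g(Z, V)` and `g(V, Y)` vanish on the fiber and `[Y, Z]` is tangent to the
leaves. What remains is `-(L_V g)(Y, Z) / 2`, which vanishes because `V` is tangent to the orbits.
-/
theorem isTotallyGeodesicFoliation_perpLeaf :
    IsTotallyGeodesicFoliation X.metric (fiber X p) (perpLeaf X p) := by
  intro x hx Y Z V hY hZ hV
  obtain ⟨θ, hθ, hVθ⟩ := exists_coeff Complex.I_ne_zero hx (fun w hw => normalDist_perpLeaf hw) hV
  obtain ⟨s, hs, hYs⟩ := exists_coeff one_ne_zero hx (fun w hw => tangentDist_perpLeaf hw) hY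
  obtain ⟨r, hr, hZr⟩ := exists_coeff one_ne_zero hx (fun w hw => tangentDist_perpLeaf hw) hZ
  have hVd : DifferentiableAt ℝ V x := hV.1.differentiableAt (by simp)
  have hYd : DifferentiableAt ℝ Y x := hY.1.differentiableAt (by simp)
  have hZd : DifferentiableAt ℝ Z x := hZ.1.differentiableAt (by simp)
  have hperp : ∀ w ∈ fiber X p, ∀ u ∈ realDist 1 w, ∀ v ∈ realDist Complex.I w,
      X.metric w u v = 0 := by
    intro w hw u hu v hv
    rw [← mul_one Complex.I, ← orthogonal_realDist one_ne_zero hw] at hv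
    exact hv.2 u hu
  have hzero : ∀ (U : Cn k → Cn k) (q : Cn k → Fin l → ℝ) (_ : DifferentiableAt ℝ U x)
      (_ : U =ᶠ[𝓝[fiber X p] x] fun y => scale (fun j => 1 * q y j) y) (c : Fin l → ℂ),
      fderiv ℝ (fun y => X.metric y (U y) (V y)) x (scale c x) = 0 := by
    intro U q hU hUq c
    have hc : scale c x ∈ tangentSet (fiber X p) x := by
      rw [tangentSet_fiber hx]
      exact ⟨c, rfl⟩
    rw [fderiv_apply_eq_of_mem_tangentSet (g := fun _ => 0)
      (X.differentiableAt_metric hx.2.2 differentiableAt_fun_id hU hVd)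
      (differentiableAt_const _) ?_ hc]
    · simp
    · filter_upwards [hUq, hVθ, self_mem_nhdsWithin] with y h1 h2 hy
      rw [h1, h2]
      exact hperp y hy _ ⟨q y, rfl⟩ _ ⟨θ y, rfl⟩
  have hYx := eq_scale_of_eventuallyEq hx hYs
  have hZx := eq_scale_of_eventuallyEq hx hZr
  have hVx := eq_scale_of_eventuallyEq hx hVθ
  have h1 : fderiv ℝ (fun y => X.metric y (Z y) (V y)) x (Y x) = 0 := by
    rw [hYx]
    exact hzero Z r hZd hZr _
  have h2 : fderiv ℝ (fun y => X.metric y (V y) (Y y)) x (Z x) = 0 := by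
    simp only [X.metric_comm _ (V _)]
    rw [hZx]
    exact hzero Y s hYd hYs _
  have h3 : X.metric x (VectorField.lieBracket ℝ Y Z x) (V x) = 0 := by
    rw [lieBracket_section hx hYd hs hYs hZd hr hZr, hVx]
    refine hperp x hx _ ⟨fderiv ℝ r x (Y x) - fderiv ℝ s x (Z x), ?_⟩ _ ⟨θ x, rfl⟩
    congr 1
    funext j
    simp
  have h4 : ∀ (U U' : Cn k → Cn k) (q q' : Cn k → Fin l → ℝ), DifferentiableAt ℝ U x →
      DifferentiableAt ℝ q x → (U =ᶠ[𝓝[fiber X p] x] fun y => scale (fun j => 1 * q y j) y) →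
      (U' =ᶠ[𝓝[fiber X p] x] fun y => scale (fun j => 1 * q' y j) y) →
      X.metric x (VectorField.lieBracket ℝ U V x) (U' x)
        = -coeffMetric X x (fderiv ℝ q x (V x)) (q' x) := by
    intro U U' q q' hU hq hUq hUq'
    have hb := lieBracket_section hx hVd hθ hVθ hU hq hUq
    -- The sign is written as a complex scalar so that it can be pulled out of the Hermitian form.
    have hm : VectorField.lieBracket ℝ U V x = ((-1 : ℝ) : ℂ) • VectorField.lieBracket ℝ V U x := by
      rw [VectorField.lieBracket_swap]
      simp
    rw [hm, KahlerGeometry.metric, KahlerGeometry.hermitian_smul_left, Complex.re_ofReal_mul,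
      mul_left_comm, ← KahlerGeometry.metric, hb, eq_scale_of_eventuallyEq hx hUq',
      metric_scale_I_sub, neg_one_mul]
  rw [leviCivita, h1, h2, h3, h4 Y Z s r hYd hs hYs hZr, h4 Z Y r s hZd hr hZr hYs,
    fderiv_metric_apply hx hYd hs hYs hZd hr hZr ⟨θ x, hVx⟩, coeffMetric_comm X x (s x)]
  ring

/-- The global frame `scale (Pi.single i e) y` is linear in `y` and independent because no block
vanishes; brackets of sections again have coefficients in `eℝ`. -/
theorem isSmoothFoliation_of_realDist (he : e ≠ 0) {leaf : Cn k → Set (Cn k)}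
    (hT : ∀ w ∈ fiber X p, tangentDist leaf w = realDist e w)
    (hleaf : ∀ w ∈ fiber X p, leaf w = expLeaf X e w) :
    IsSmoothFoliation (fiber X p) l leaf where
  smooth x hx := by
    have hsum : ∀ (a : Fin l → ℝ) (y : Cn k), ∑ i, a i • scale (Pi.single i e) y
        = scale (fun j => e * a j) y := by
      intro a y
      ext i
      simp [Pi.single_apply, mul_left_comm, mul_assoc]
    refine ⟨fun i y => scale (Pi.single i e) y,
      fun i => (scaleBilin (Pi.single i e)).contDiff.contDiffAt, ?_⟩
    filter_upwards [self_mem_nhdsWithin] with y hy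
    constructor
    · rw [Fintype.linearIndependent_iff]
      intro a ha j
      rw [hsum] at ha
      have h0 : scale (fun j => e * a j) y = scale 0 y := by rw [ha]; ext i; simp
      simpa [he] using congrFun (scale_injective hy.1 h0) j
    · rw [hT y hy]
      ext v
      rw [SetLike.mem_coe, Submodule.mem_span_range_iff_exists_fun]
      exact exists_congr fun a => by rw [hsum, eq_comm]
  involutive x hx V W hV hW := by
    obtain ⟨s, hs, hVs⟩ := exists_coeff he hx hT hV
    obtain ⟨r, hr, hWr⟩ := exists_coeff he hx hT hW
    rw [lieBracket_section hx (hV.1.differentiableAt (by simp)) hs hVs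
      (hW.1.differentiableAt (by simp)) hr hWr, hT x hx]
    refine ⟨fderiv ℝ r x (V x) - fderiv ℝ s x (W x), congrArg (scale · x) ?_⟩
    funext j
    simp [mul_sub]
  leaf_eq x hx := by rw [hleaf x hx, accessibleSet_fiber he hT hx]

theorem isLagrangianFrame_fiber (X : KahlerGeometry) (p : ProjProd k) :
    IsLagrangianFrame X.metric X.form (fiber X p) l orbitLeaf (perpLeaf X p) where
  foliationO := isSmoothFoliation_of_realDist Complex.I_ne_zero
    (fun _ hw => tangentDist_orbitLeaf (mem_VkU_of_mem_fiber hw))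
    (fun _ hw => orbitLeaf_eq_expLeaf (mem_VkU_of_mem_fiber hw))
  foliationF := isSmoothFoliation_of_realDist one_ne_zero
    (fun _ hw => tangentDist_perpLeaf hw) (fun _ hw => perpLeaf_eq_expLeaf hw)
  lagrangianO x hx := by
    rw [tangentDist_orbitLeaf (mem_VkU_of_mem_fiber hx), lagrangian_realDist Complex.I_ne_zero hx]
  lagrangianF x hx := by
    rw [tangentDist_perpLeaf hx, lagrangian_realDist one_ne_zero hx]
  orthogonal x hx u hu v hv := by
    rw [tangentDist_perpLeaf hx, ← normalDist_orbitLeaf hx] at hv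
    exact hv.2 u hu
  riemannianO := isRiemannianFoliation_orbitLeaf
  totallyGeodesicF := isTotallyGeodesicFoliation_perpLeaf

/-- The fiber is open in the linear space `S` of blockwise multiples of `x`, so the quotient map by
`S`, in coordinates, is a defining submersion. -/
theorem isComplexSubmanifold_fiber (X : KahlerGeometry) (p : ProjProd k) :
    IsComplexSubmanifold l (fiber X p) := by
  intro x hx
  let L : (Fin l → ℂ) →ₗ[ℂ] Cn k :=
    { toFun := fun c => scale c x
      map_add' := fun c d => add_scale c d x
      map_smul' := fun a c => smul_scale a c x }
  have hL : Function.Injective L := scale_injective hx.1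
  let S : Submodule ℂ (Cn k) := LinearMap.range L
  let F : Cn k →L[ℂ] (Fin (Module.finrank ℂ (Cn k ⧸ S)) → ℂ) := LinearMap.toContinuousLinearMap
    ((Module.finBasis ℂ (Cn k ⧸ S)).equivFun.toLinearMap.comp S.mkQ)
  have hker : LinearMap.ker F.toLinearMap = S := by
    change LinearMap.ker ((Module.finBasis ℂ (Cn k ⧸ S)).equivFun.toLinearMap.comp S.mkQ) = S
    rw [LinearEquiv.ker_comp, Submodule.ker_mkQ]
  refine ⟨_, F, F.contDiff.contDiffAt, ?_, ?_, ?_⟩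
  · rw [F.fderiv]
    exact (Module.finBasis ℂ (Cn k ⧸ S)).equivFun.surjective.comp S.mkQ_surjective
  · rw [F.fderiv, hker, LinearMap.finrank_range_of_inj hL, Module.finrank_fin_fun]
  · filter_upwards [(Vk k).isOpen.mem_nhds hx.1, X.isOpen_domain.mem_nhds hx.2.2] with y hyV hyU
    have hFy : F y = 0 ↔ y ∈ S := (SetLike.ext_iff.1 hker y)
    rw [hFy]
    constructor
    · intro hy
      obtain ⟨c, -, hc⟩ := exists_scale_eq hx hy
      exact ⟨c, hc.symm⟩
    · rintro ⟨c, rfl⟩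
      -- A zero coefficient would kill a whole block, which is excluded in `V_k`.
      refine scale_mem_fiber hx (fun j hj => hyV j ?_) hyU
      funext a
      change c j * x ⟨j, a⟩ = 0
      rw [hj, zero_mul]

/-! ### The action of `𝕋ⁿ` on the fibers -/

theorem isRiemannianIsometryOn_smul {b : CStar k} (hb : b ∈ torus k) (X : KahlerGeometry) :
    IsRiemannianIsometryOn X.metric (VkU k X) (fun z => b • z) := by
  let L : Cn k →ₗ[ℝ] Cn k :=
    { toFun := fun z => b • z
      map_add' := fun z w => by ext i; simp
      map_smul' := fun a z => by ext i; simp [mul_left_comm] }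
  let F : Cn k →L[ℝ] Cn k := LinearMap.toContinuousLinearMap L
  have hF : (fun z : Cn k => b • z) = F := rfl
  have hmaps : ∀ c ∈ torus k, Set.MapsTo (fun z : Cn k => c • z) (VkU k X) (VkU k X) :=
    fun c hc z hz => ⟨smul_mem_Vk c hz.1, (torus_smul_mem_domain hc).2 hz.2⟩
  refine ⟨?_, ?_, ?_⟩
  · exact Set.InvOn.bijOn (f' := fun z => b⁻¹ • z)
      ⟨fun z _ => inv_smul_smul b z, fun z _ => smul_inv_smul b z⟩
      (hmaps b hb) (hmaps b⁻¹ (inv_mem hb))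
  · rw [hF]
    exact F.contDiff.contDiffOn
  · intro z _ u v
    rw [hF, F.fderiv]
    exact metric_torus_smul hb z u v

theorem smul_mem_fiber {b : CStar k} (hb : b ∈ torus k) {z : Cn k} (hz : z ∈ fiber X p) :
    b • z ∈ fiber X (b • p) := by
  obtain ⟨h, rfl, hd⟩ := hz
  exact ⟨smul_mem_Vk b h, rfl, (torus_smul_mem_domain hb).2 hd⟩

theorem image_smul_fiber {b : CStar k} (hb : b ∈ torus k) (X : KahlerGeometry) (p : ProjProd k) :
    (fun z => b • z) '' fiber X p = fiber X (b • p) := by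
  refine Set.Subset.antisymm ?_ fun w hw => ?_
  · rintro _ ⟨z, hz, rfl⟩
    exact smul_mem_fiber hb hz
  · refine ⟨b⁻¹ • w, ?_, smul_inv_smul b w⟩
    simpa using smul_mem_fiber (inv_mem hb) hw

theorem image_smul_expLeaf {b : CStar k} (hb : b ∈ torus k) (e : ℂ) (z : Cn k) :
    (fun w => b • w) '' expLeaf X e z = expLeaf X e (b • z) := by
  ext w
  constructor
  · rintro ⟨_, ⟨⟨s, rfl⟩, hd⟩, rfl⟩
    exact ⟨⟨s, smul_scale_comm _ _ _⟩, (torus_smul_mem_domain hb).2 hd⟩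
  · rintro ⟨⟨s, rfl⟩, hd⟩
    rw [← smul_scale_comm, torus_smul_mem_domain hb] at hd
    exact ⟨_, ⟨⟨s, rfl⟩, hd⟩, smul_scale_comm _ _ _⟩

end VectorFields

theorem mainTheorem8 {l : ℕ} (k : Fin l → ℕ) (hk : ∀ j, 0 < k j) :
    -- `π_k : V_k → ∏_j ℙ^{k_j - 1}(ℂ)` is a principal bundle with group `A_k ≅ (ℂ*)^l`,
    IsHolomorphicPrincipalBundle 𝓘(ℂ, Cn k) (projProdModel k) (groupModel l) (Fin l → ℂˣ)
      (projPi k) ∧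
    -- and the elements of `B_k` act on it by principal bundle automorphisms.
    (∀ b ∈ Bk k, IsPrincipalBundleAutomorphism 𝓘(ℂ, Cn k) (projProdModel k) (Fin l → ℂˣ)
      (projPi k) (fun z => b • z) (fun p => b • p)) ∧
    ∀ X : KahlerGeometry,
      -- The `T_k`-orbits and their orthogonal foliation form a Lagrangian frame of each fiber;
      (∀ p : ProjProd k, IsComplexSubmanifold l (fiber X p) ∧
        IsLagrangianFrame X.metric X.form (fiber X p) l orbitLeaf (perpLeaf X p)) ∧
      ∀ b ∈ torus k ⊓ Bk k,
        -- `𝕋ⁿ ∩ B_k` acts isometrically on `V_k ∩ 𝕌ⁿ`,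
        IsRiemannianIsometryOn X.metric (VkU k X) (fun z => b • z) ∧
        -- and it permutes the fibers and their Lagrangian frames.
        ∀ p : ProjProd k,
          (fun z => b • z) '' fiber X p = fiber X (b • p) ∧
          ∀ z ∈ fiber X p,
            (fun w => b • w) '' orbitLeaf z = orbitLeaf (b • z) ∧
            (fun w => b • w) '' perpLeaf X p z = perpLeaf X (b • p) (b • z) := by
  refine ⟨isHolomorphicPrincipalBundle_projPi, fun b _ => isPrincipalBundleAutomorphism_smul b,
    fun X => ⟨fun p => ⟨isComplexSubmanifold_fiber X p, isLagrangianFrame_fiber X p⟩,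
      fun b hb => ⟨isRiemannianIsometryOn_smul hb.1 X, fun p => ⟨image_smul_fiber hb.1 X p,
        fun z hz => ?_⟩⟩⟩⟩
  have hbz := smul_mem_fiber hb.1 hz
  rw [perpLeaf_eq_expLeaf hz, perpLeaf_eq_expLeaf hbz,
    orbitLeaf_eq_expLeaf (mem_VkU_of_mem_fiber hz), orbitLeaf_eq_expLeaf (mem_VkU_of_mem_fiber hbz)]
  exact ⟨image_smul_expLeaf hb.1 _ z, image_smul_expLeaf hb.1 _ z⟩
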